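/- **Setting.** Let $\Omega=B(0;1)\subset\mathbb R^3$ be the open unit ball, with outward normal $n(x)=x$ on $\partial\Omega$. Put $\gamma=\partial\Omega\times\mathbb R^3$, $\gamma_\pm=\{(x,v)\in\gamma:\pm n(x)\cdot v>0\}$, $\gamma_0=\{(x,v)\in\gamma: n(x)\cdot v=0\}$ and $d\gamma=|n(x)\cdot v|\,dS_x\,dv$, where $dS_x$ is the surface measure of the sphere. Let $\mu(v)=e^{-|v|^2/2}$ and $c_\mu=\frac1{2\pi}$, so that $c_\mu\int_{n\cdot u>0}\mu(u)\{n\cdot u\}\,du=1$ for every unit vector $n$. For a function $f_0(x,v)$, consider free transport with the diffuse boundary condition: $$\partial_t f+v\cdot\nabla_x f=0\ \text{ in }(0,\infty)\times\Omega\times\mathbb R^3,\qquad f|_{t=0}=f_0,$$ $$f(t,x,v)=c_\mu\sqrt{\mu(v)}\int_{n(x)\cdot u>0}f(t,x,u)\sqrt{\mu(u)}\{n(x)\cdot u\}\,du\quad\text{for }t\ge 0,\ (x,v)\in\gamma_-.\qquad(1)$$ A *solution* is a function that satisfies (1) pointwise, is continuous on $[0,\infty)\times\big((\bar\Omega\times\mathbb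 R^3)\setminus\gamma_0\big)$ and bounded there on bounded time intervals, and is $C^1$ on $(0,\infty)\times\Omega\times\mathbb R^3$. On $\gamma_\pm$, $\nabla_xf(t)$ and $\nabla_vf(t)$, $t>0$, denote the limits of the interior gradients at the points of $(0,\infty)\times\gamma_\pm$. An *admissible datum* is a nonnegative $f_0\in C^\infty$ whose support is a compact subset of $B(0;1)\times B(0;1)$. **Lemma.** (a) There is an admissible datum $f_0$ for which (1) has a solution $f$, unique on $[0,\infty)\times\big((\bar\Omega\times\mathbb R^3)\setminus\gamma_0\big)$, such that the limits of $\nabla_xf$ and $\nabla_vf$ exist at every point of $(0,\infty)\times(\gamma_+\cup\gamma_-)$, and $$\int_0^1\int_{\gamma_-}|\nabla_xf(s,x,v)|^2\,d\gamma\,ds=+\infty .$$ (b) Consequently the following $W^{1,p}$ estimate fails for $p=2$. For every $\theta\in(0,\frac14)$ there do **not** exist a function $T(\cdot)>0$, constants $C_t\ge0$ depending only on $t$, and a polynomial $P$ such that, for every admissible datum $f_0$, every solution $f$ of (1) whose gradients have limits at all points of $(0,\infty)\times(\gamma_+\cup\gamma_-)$, and all $0\le t\le T(\|e^{\theta|v|^2}f_0\|_\infty)$,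 $$\|\nabla_xf(t)\|_p^p+\|\nabla_vf(t)\|_p^p+\int_0^t\int_\gamma\big(|\nabla_xf(s)|^p+|\nabla_vf(s)|^p\big)\,d\gamma\,ds\le C_t\Big(\|\nabla_xf_0\|_p^p+\|\nabla_vf_0\|_p^p+\max\{P(\|e^{\theta|v|^2}f_0\|_\infty),0\}\Big)$$ holds with $p=2$; here $\|\cdot\|_p$ and $\|\cdot\|_\infty$ are the norms on $\Omega\times\mathbb R^3$. -/

import Mathlib

open MeasureTheory Set Filter Topology
open scoped RealInnerProductSpace ENNReal NNReal ContDiff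

namespace KineticBall

noncomputable section

/-- Physical space, and velocity space, `ℝ³` with its Euclidean norm. -/
abbrev E3 : Type := EuclideanSpace ℝ (Fin 3)

/-- The domain: the open unit ball. Its boundary is the unit sphere, with outward normal
`n(x) = x`. -/
def Omega : Set E3 := Metric.ball 0 1

/-- The phase space up to the boundary, without the grazing set
`γ₀ = {(x, v) : |x| = 1, n(x) · v = 0}`. -/
def phaseOffGrazing : Set (E3 × E3) :=
  {p | ‖p.1‖ ≤ 1 ∧ ¬ (‖p.1‖ = 1 ∧ ⟪p.1, p.2⟫ = 0)}

/-- The Maxwellian `μ(v) = exp (-|v|² / 2)`. -/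
def maxwellian (v : E3) : ℝ := Real.exp (-‖v‖ ^ 2 / 2)

/-- The normalizing constant `c_μ`; its defining property is `cMu_mul_integral`. -/
def cMu : ℝ := (2 * Real.pi)⁻¹

/-- `c_μ ∫_{n · u > 0} μ(u) (n · u) du = 1` for every unit vector `n`. -/
theorem cMu_mul_integral (n : E3) (hn : ‖n‖ = 1) :
    cMu * ∫ u in {u : E3 | 0 < ⟪n, u⟫}, maxwellian u * ⟪n, u⟫ = 1 := by
  obtain ⟨b, hb⟩ := Orthonormal.exists_orthonormalBasis_extension_of_card_eq
    (𝕜 := ℝ) (E := E3) (ι := Fin 3) (by simp) (v := fun _ => n) (s := {0})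
    ⟨fun i => by simpa using hn, fun i j hij => (hij (Subsingleton.elim i j)).elim⟩
  have hb0 : b 0 = n := hb 0 rfl
  have hr : ∀ u : E3, ⟪n, u⟫ = (b.repr u) 0 := fun u => by
    rw [← hb0, b.repr_apply_apply]
  let F : E3 → ℝ := fun w => indicator {w : E3 | 0 < w 0} (fun w => maxwellian w * w 0) w
  have hms : MeasurableSet {u : E3 | 0 < ⟪n, u⟫} :=
    measurableSet_lt measurable_const (by fun_prop)
  have h1 : ∫ u in {u : E3 | 0 < ⟪n, u⟫}, maxwellian u * ⟪n, u⟫ = ∫ u, F (b.repr u) := by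
    rw [← integral_indicator hms]
    congr 1
    ext u
    simp only [F, indicator, mem_ofPred_eq, hr, maxwellian, b.repr.norm_map]
  let G : Fin 3 → ℝ → ℝ := fun i y =>
    if i = 0 then indicator (Ioi 0) (fun y => Real.exp (-(1 / 2) * y ^ 2) * y) y
    else Real.exp (-(1 / 2) * y ^ 2)
  have h2 : ∫ w, F w = ∫ y : Fin 3 → ℝ, ∏ i, G i (y i) := by
    rw [← (PiLp.volume_preserving_toLp (Fin 3)).integral_comp
      (MeasurableEquiv.toLp 2 (Fin 3 → ℝ)).measurableEmbedding]
    congr 1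
    ext y
    have hy : -‖(WithLp.toLp 2 y : E3)‖ ^ 2 / 2
        = -(1 / 2) * y 0 ^ 2 + -(1 / 2) * y 1 ^ 2 + -(1 / 2) * y 2 ^ 2 := by
      rw [EuclideanSpace.norm_sq_eq, Fin.sum_univ_three]
      simp only [Real.norm_eq_abs, sq_abs]
      ring
    simp only [F, G, indicator, mem_ofPred_eq, maxwellian, hy, Fin.prod_univ_three, mem_Ioi,
      Real.exp_add]
    by_cases h : 0 < y 0
    · simp [h]
      ring
    · simp [h]
  have h3 : ∫ y, G 0 y = 1 := by
    simp only [G, if_true]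
    rw [integral_indicator measurableSet_Ioi]
    have := integral_rpow_mul_exp_neg_mul_rpow (p := 2) (q := 1) (b := 1 / 2)
      (by norm_num) (by norm_num) (by norm_num)
    norm_num [Real.rpow_neg_one] at this
    refine Eq.trans ?_ this
    congr 1
    ext y
    rw [mul_comm]
    norm_num
  have h4 : ∀ i : Fin 3, i ≠ 0 → ∫ y, G i y = √(2 * Real.pi) := fun i hi => by
    simp only [G, if_neg hi]
    rw [integral_gaussian]
    congr 1
    ring
  rw [h1, (b.measurePreserving_repr).integral_comp b.repr.toHomeomorph.measurableEmbedding F, h2,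
    integral_fintype_prod_volume_eq_prod, Fin.prod_univ_three, h3, h4 1 (by decide),
    h4 2 (by decide), one_mul, Real.mul_self_sqrt (by positivity), cMu]
  exact inv_mul_cancel₀ (by positivity)

/-- Initial data: smooth, nonnegative, with compact support inside `B(0;1) × B(0;1)`. -/
structure IsDatum (f₀ : E3 → E3 → ℝ) : Prop where
  smooth : ContDiff ℝ ∞ (fun p : E3 × E3 => f₀ p.1 p.2)
  compact : HasCompactSupport (fun p : E3 × E3 => f₀ p.1 p.2)
  support : tsupport (fun p : E3 × E3 => f₀ p.1 p.2) ⊆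
    Metric.ball (0 : E3) 1 ×ˢ Metric.ball (0 : E3) 1
  nonneg : ∀ x v, 0 ≤ f₀ x v

/-- The spatial gradient `∇ₓ f (t, x, v)`. -/
def gradX (f : ℝ → E3 → E3 → ℝ) (t : ℝ) (x v : E3) : E3 :=
  gradient (fun y => f t y v) x

/-- The velocity gradient `∇ᵥ f (t, x, v)`. -/
def gradV (f : ℝ → E3 → E3 → ℝ) (t : ℝ) (x v : E3) : E3 :=
  gradient (fun w => f t x w) v

/-- Classical solutions `f(t, x, v)`, `t ≥ 0`, of the free transport equation in the unit ball
with the diffuse boundary condition and initial datum `f₀`: continuous up to the boundary away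
from the grazing set, bounded on bounded time intervals, and `C¹` in the interior. -/
structure IsSolution (f₀ : E3 → E3 → ℝ) (f : ℝ → E3 → E3 → ℝ) : Prop where
  continuousOn : ContinuousOn (fun q : ℝ × E3 × E3 => f q.1 q.2.1 q.2.2)
    (Ici 0 ×ˢ phaseOffGrazing)
  bounded : ∀ T : ℝ, ∃ K : ℝ, ∀ t ∈ Icc 0 T, ∀ p ∈ phaseOffGrazing, |f t p.1 p.2| ≤ K
  contDiffOn : ContDiffOn ℝ 1 (fun q : ℝ × E3 × E3 => f q.1 q.2.1 q.2.2)
    (Ioi 0 ×ˢ Omega ×ˢ univ)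
  transport : ∀ t, 0 < t → ∀ x ∈ Omega, ∀ v,
    deriv (fun s => f s x v) t + ⟪v, gradX f t x v⟫ = 0
  initial : ∀ x ∈ Omega, ∀ v, f 0 x v = f₀ x v
  diffuse : ∀ t, 0 ≤ t → ∀ x v, ‖x‖ = 1 → ⟪x, v⟫ < 0 →
    f t x v = cMu * √(maxwellian v) *
      ∫ u in {u : E3 | 0 < ⟪x, u⟫}, f t x u * √(maxwellian u) * ⟪x, u⟫

/-- `D` is the trace on `(0, ∞) × (γ₊ ∪ γ₋)` of the field `h`, defined in the interior
`(0, ∞) × Ω × ℝ³`: the limit of `h` at the boundary point from the interior. -/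
def IsTrace (h D : ℝ → E3 → E3 → E3) : Prop :=
  ∀ t, 0 < t → ∀ x v, ‖x‖ = 1 → ⟪x, v⟫ ≠ 0 →
    Tendsto (fun q : ℝ × E3 × E3 => h q.1 q.2.1 q.2.2)
      (𝓝[Ioi 0 ×ˢ Omega ×ˢ univ] (t, x, v)) (𝓝 (D t x v))

/-- The measure `dγ = |n(x) · v| dSₓ dv` on `γ = ∂Ω × ℝ³`, where `dSₓ` is the surface measure of
the unit sphere. -/
def gammaMeasure : Measure (Metric.sphere (0 : E3) 1 × E3) :=
  ((volume : Measure E3).toSphere.prod volume).withDensity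
    (fun p => ENNReal.ofReal |⟪(p.1 : E3), p.2⟫|)

/-- The incoming set `γ₋`. -/
def gammaMinus : Set (Metric.sphere (0 : E3) 1 × E3) := {p | ⟪(p.1 : E3), p.2⟫ < 0}

/-- `‖h‖_p^p` on `Ω × ℝ³`. -/
def bulkNormPow (p : ℝ) (h : E3 → E3 → E3) : ℝ≥0∞ :=
  ∫⁻ z in Omega ×ˢ (univ : Set E3), ‖h z.1 z.2‖ₑ ^ p

/-- `|h|_{γ,p}^p` on `γ = ∂Ω × ℝ³`. -/
def boundaryNormPow (p : ℝ) (h : E3 → E3 → E3) : ℝ≥0∞ :=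
  ∫⁻ z, ‖h z.1 z.2‖ₑ ^ p ∂gammaMeasure

/-- `‖exp (θ |v|²) f₀‖_∞` on `Ω × ℝ³`. -/
def weightedSupNorm (θ : ℝ) (f₀ : E3 → E3 → ℝ) : ℝ :=
  (eLpNorm (fun z : E3 × E3 => Real.exp (θ * ‖z.2‖ ^ 2) * f₀ z.1 z.2) ∞
    (volume.restrict (Omega ×ˢ (univ : Set E3)))).toReal

/-- The `W^{1,p}` a priori estimate for free transport with the diffuse boundary condition, for
data of class `IsDatum`: there are a lifespan `T > 0` depending only on `‖exp (θ |v|²) f₀‖_∞`, a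
constant `C` depending only on `t` and a polynomial `P` such that, for `0 ≤ t ≤ T`,
`‖∇ₓ f(t)‖_p^p + ‖∇ᵥ f(t)‖_p^p + ∫₀ᵗ (|∇ₓ f(s)|_{γ,p}^p + |∇ᵥ f(s)|_{γ,p}^p) ds`
`  ≤ C (‖∇ₓ f₀‖_p^p + ‖∇ᵥ f₀‖_p^p + P(‖exp (θ |v|²) f₀‖_∞))`.
On `γ` the gradients are the traces `Dx`, `Dv`; `γ₀` has `dγ`-measure zero. -/
def GradientEstimate (p θ : ℝ) : Prop :=
  ∃ (T : ℝ → ℝ) (C : ℝ → ℝ≥0) (P : Polynomial ℝ), (∀ M, 0 < T M) ∧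
    ∀ f₀ : E3 → E3 → ℝ, IsDatum f₀ →
    ∀ f : ℝ → E3 → E3 → ℝ, IsSolution f₀ f →
    ∀ Dx Dv : ℝ → E3 → E3 → E3, IsTrace (gradX f) Dx → IsTrace (gradV f) Dv →
    ∀ t, 0 ≤ t → t ≤ T (weightedSupNorm θ f₀) →
      bulkNormPow p (gradX f t) + bulkNormPow p (gradV f t) +
          ∫⁻ s in Icc 0 t, (boundaryNormPow p (Dx s) + boundaryNormPow p (Dv s))
        ≤ C t * (bulkNormPow p (fun x v => gradient (fun y => f₀ y v) x) +
            bulkNormPow p (fun x v => gradient (fun w => f₀ x w) v) +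
            ENNReal.ofReal (P.eval (weightedSupNorm θ f₀)))

end

end KineticBall

/-! Take the datum `√μ G` with `G` invariant under simultaneous rotation of `x` and `v`. The
outgoing flux is then the same number `m t` at every boundary point, and following each particle
back to its last boundary hit turns the problem into the scalar renewal equation `m t = a t + ∫ m (t
- τ u) dP(u)`. Here `τ` is the time of flight through the ball, `P` the probability measure
`fluxMeasure`, and `a` the flux of particles that have not yet hit the boundary. `exists_renewal`
gives a `C¹` solution `m`, and `isSolution_transportSol` shows that `√μ(v) (G(x - tv, v) + m(t -
exitTime x v))` solves the problem.

The exit time has normal derivative `1 / (n · v)` at incoming boundary points, so there `|∇ₓ f| ≥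
|m'(t)| √μ(v) / |n · v|` (`le_norm_gradX_transportSol`). Squaring and multiplying by `|n · v|`
leaves `m'(t)² μ(v) / |n · v|`, which diverges logarithmically at the grazing set
(`boundary_lintegral_eq_top`). Since `m` vanishes for `t ≤ 0` but not identically, `m' ≠ 0` on an
open set of times, and the space-time integral is infinite.

Uniqueness: the difference of two solutions is governed by the difference of their boundary fluxes.
The weight `e^{-t}` makes the flux map a contraction with factor `E[e^{-τ}] < 1`
(`IsSolution.fluxDiff_eq_zero`).

To refute the estimate, the amplitude is normalized so that the weighted norm is `1`. The lifespan
`T 1` is thereby fixed beforehand, and the bump is made wide enough to reach the boundary within it.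
-/

namespace KineticBall

noncomputable section

/-! ### Geometry of the backward exit time. -/

/-- The discriminant of the quadratic equation `|x - t v|² = 1` in `t`. -/
def exitDisc (x v : E3) : ℝ := ⟪x, v⟫ ^ 2 + ‖v‖ ^ 2 * (1 - ‖x‖ ^ 2)

/-- The backward exit time from the unit ball along the line through `x` with velocity `v`. -/
def exitTime (x v : E3) : ℝ := (⟪x, v⟫ + √(exitDisc x v)) / ‖v‖ ^ 2

theorem exitDisc_ge {x : E3} (hx : ‖x‖ ≤ 1) (v : E3) : ⟪x, v⟫ ^ 2 ≤ exitDisc x v := by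
  have : ‖x‖ ^ 2 ≤ 1 := by nlinarith [norm_nonneg x]
  unfold exitDisc
  nlinarith [mul_nonneg (sq_nonneg ‖v‖) (sub_nonneg.2 this)]

theorem exitDisc_nonneg {x : E3} (hx : ‖x‖ ≤ 1) (v : E3) : 0 ≤ exitDisc x v :=
  (sq_nonneg _).trans (exitDisc_ge hx v)

theorem exitDisc_pos {x v : E3} (h : (x, v) ∈ phaseOffGrazing) (hv : v ≠ 0) :
    0 < exitDisc x v := by
  obtain ⟨h1, h2⟩ := h
  simp only [not_and] at h1 h2
  rcases h1.lt_or_eq with h1 | h1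
  · have h3 : 0 < 1 - ‖x‖ ^ 2 := by nlinarith [norm_nonneg x]
    have := mul_pos (pow_pos (norm_pos_iff.2 hv) 2) h3
    unfold exitDisc
    positivity
  · exact (pow_pos (abs_pos.2 (h2 h1)) 2 |>.trans_eq (sq_abs _)).trans_le (exitDisc_ge h1.le v)

theorem exitTime_nonneg {x : E3} (hx : ‖x‖ ≤ 1) (v : E3) : 0 ≤ exitTime x v := by
  have h := Real.abs_le_sqrt (exitDisc_ge hx v)
  have := neg_abs_le ⟪x, v⟫
  unfold exitTime
  exact div_nonneg (by linarith) (sq_nonneg _)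

/-- Factorization of the quadratic `|x - tv|² - 1` by its two roots in `t`; the larger root is
`exitTime x v`. -/
theorem norm_sub_smul_sq {x v : E3} (hx : 0 ≤ exitDisc x v) (hv : v ≠ 0) (t : ℝ) :
    ‖x - t • v‖ ^ 2 =
      1 + (‖v‖ ^ 2 * t - ⟪x, v⟫ - √(exitDisc x v)) * (t - ⟪x, v⟫ / ‖v‖ ^ 2 +
        √(exitDisc x v) / ‖v‖ ^ 2) := by
  have h0 : ‖v‖ ≠ 0 := norm_ne_zero_iff.2 hv
  have h1 := Real.sq_sqrt hx
  rw [norm_sub_sq_real, inner_smul_right, norm_smul, mul_pow, Real.norm_eq_abs, sq_abs]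
  field_simp
  unfold exitDisc at *
  linear_combination h1

theorem sub_exitTime {x v : E3} (hv : v ≠ 0) (t : ℝ) :
    ‖v‖ ^ 2 * t - ⟪x, v⟫ - √(exitDisc x v) = ‖v‖ ^ 2 * (t - exitTime x v) := by
  have h0 : ‖v‖ ≠ 0 := norm_ne_zero_iff.2 hv
  unfold exitTime
  field_simp
  ring

theorem le_exitTime {x v : E3} (hv : v ≠ 0) {t : ℝ} (h : ‖x - t • v‖ ≤ 1) :
    t ≤ exitTime x v := by
  have h0 : 0 < ‖v‖ := norm_pos_iff.2 hv
  have h1 : ‖x - t • v‖ ^ 2 ≤ 1 := by nlinarith [norm_nonneg (x - t • v)]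
  rw [norm_sub_sq_real, inner_smul_right, norm_smul, mul_pow, Real.norm_eq_abs, sq_abs] at h1
  have h2 : (‖v‖ ^ 2 * t - ⟪x, v⟫) ^ 2 ≤ exitDisc x v := by
    unfold exitDisc
    nlinarith [mul_le_mul_of_nonneg_left h1 (sq_nonneg ‖v‖)]
  have h3 := (le_abs_self _).trans (Real.abs_le_sqrt h2)
  rw [exitTime, le_div_iff₀ (by positivity)]
  linarith

theorem norm_sub_smul_lt_one {x v : E3} (hx : ‖x‖ ≤ 1) (hv : v ≠ 0) {t : ℝ} (h0 : 0 < t)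
    (ht : t < exitTime x v) : ‖x - t • v‖ < 1 := by
  have h1 := norm_sub_smul_sq (exitDisc_nonneg hx v) hv t
  rw [sub_exitTime hv] at h1
  have h2 : ⟪x, v⟫ ≤ √(exitDisc x v) :=
    (le_abs_self _).trans (Real.abs_le_sqrt (exitDisc_ge hx v))
  have h3 : 0 < t - ⟪x, v⟫ / ‖v‖ ^ 2 + √(exitDisc x v) / ‖v‖ ^ 2 := by
    have := div_le_div_of_nonneg_right h2 (sq_nonneg ‖v‖)
    linarith
  have h4 := mul_pos (mul_pos (pow_pos (norm_pos_iff.2 hv) 2) (sub_pos.2 ht)) h3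
  nlinarith [norm_nonneg (x - t • v)]

theorem norm_sub_exitTime_smul {x v : E3} (hx : ‖x‖ ≤ 1) (hv : v ≠ 0) :
    ‖x - exitTime x v • v‖ = 1 := by
  have h1 := norm_sub_smul_sq (exitDisc_nonneg hx v) hv (exitTime x v)
  rw [sub_exitTime hv, sub_self, mul_zero, zero_mul, add_zero] at h1
  exact (sq_eq_sq₀ (norm_nonneg _) zero_le_one).1 (by rw [h1, one_pow])

theorem inner_sub_exitTime_smul {x v : E3} (hv : v ≠ 0) :
    ⟪x - exitTime x v • v, v⟫ = -√(exitDisc x v) := by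
  have h0 : ‖v‖ ≠ 0 := norm_ne_zero_iff.2 hv
  rw [inner_sub_left, real_inner_smul_left, real_inner_self_eq_norm_sq, exitTime]
  field_simp
  ring

theorem exitDisc_add_smul (x v : E3) (s : ℝ) : exitDisc (x + s • v) v = exitDisc x v := by
  unfold exitDisc
  rw [norm_add_sq_real, inner_add_left, real_inner_smul_left, inner_smul_right,
    real_inner_self_eq_norm_sq, norm_smul, mul_pow, Real.norm_eq_abs, sq_abs]
  ring

theorem exitTime_add_smul {x v : E3} (hv : v ≠ 0) (s : ℝ) :
    exitTime (x + s • v) v = exitTime x v + s := by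
  have h0 : ‖v‖ ≠ 0 := norm_ne_zero_iff.2 hv
  unfold exitTime
  rw [exitDisc_add_smul, inner_add_left, real_inner_smul_left, real_inner_self_eq_norm_sq]
  field_simp
  ring

theorem sqrt_exitDisc {x : E3} (hx : ‖x‖ = 1) (v : E3) : √(exitDisc x v) = |⟪x, v⟫| := by
  rw [exitDisc, hx, one_pow, sub_self, mul_zero, add_zero, Real.sqrt_sq_eq_abs]

theorem exitTime_incoming {x v : E3} (hx : ‖x‖ = 1) (hv : ⟪x, v⟫ < 0) : exitTime x v = 0 := by
  rw [exitTime, sqrt_exitDisc hx, abs_of_neg hv, add_neg_cancel, zero_div]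

theorem exitTime_outgoing {x v : E3} (hx : ‖x‖ = 1) (hv : 0 < ⟪x, v⟫) :
    exitTime x v = 2 * ⟪x, v⟫ / ‖v‖ ^ 2 := by
  rw [exitTime, sqrt_exitDisc hx, abs_of_pos hv, two_mul]

theorem ne_zero_of_inner_ne_zero {x v : E3} (h : ⟪x, v⟫ ≠ 0) : v ≠ 0 := by
  rintro rfl
  simp at h

theorem exitTime_pos_outgoing {x v : E3} (hx : ‖x‖ = 1) (hv : 0 < ⟪x, v⟫) :
    0 < exitTime x v := by
  have h0 : 0 < ‖v‖ := norm_pos_iff.2 (ne_zero_of_inner_ne_zero hv.ne')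
  rw [exitTime_outgoing hx hv]
  positivity

theorem contDiffAt_exitTime {n : WithTop ℕ∞} {p : E3 × E3} (hv : p.2 ≠ 0)
    (hD : exitDisc p.1 p.2 ≠ 0) : ContDiffAt ℝ n (fun p : E3 × E3 => exitTime p.1 p.2) p := by
  unfold exitTime
  have h1 : ContDiffAt ℝ n (fun p : E3 × E3 => exitDisc p.1 p.2) p := by
    unfold exitDisc
    exact ((contDiff_fst.inner ℝ contDiff_snd).pow 2 |>.add
      ((contDiff_snd.norm_sq ℝ).mul (contDiff_const.sub (contDiff_fst.norm_sq ℝ)))).contDiffAt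
  exact ((contDiff_fst.inner ℝ contDiff_snd).contDiffAt.add (h1.sqrt hD)).div
    (contDiff_snd.norm_sq ℝ).contDiffAt (pow_ne_zero 2 (norm_ne_zero_iff.2 hv))

theorem exitTime_map (R : E3 ≃ₗᵢ[ℝ] E3) (x v : E3) : exitTime (R x) (R v) = exitTime x v := by
  simp only [exitTime, exitDisc, R.inner_map_map, R.norm_map]

theorem measurable_exitTime (x : E3) : Measurable (exitTime x) := by
  unfold exitTime exitDisc
  fun_prop

/-! ### The flux measure on outgoing velocities and its rotation invariance. -/

/-- The probability measure `c_μ μ(u) (x · u) du` on the half-space `{x · u > 0}`. -/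
def fluxMeasure (x : E3) : Measure E3 :=
  (volume.restrict {u : E3 | 0 < ⟪x, u⟫}).withDensity
    (fun u => ENNReal.ofReal (cMu * (maxwellian u * ⟪x, u⟫)))

theorem cMu_pos : 0 < cMu := by
  unfold cMu
  positivity

theorem maxwellian_pos (v : E3) : 0 < maxwellian v := Real.exp_pos _

theorem measurableSet_halfSpace (x : E3) : MeasurableSet {u : E3 | 0 < ⟪x, u⟫} :=
  measurableSet_lt measurable_const (by fun_prop)

theorem contDiff_maxwellian {n : WithTop ℕ∞} : ContDiff ℝ n maxwellian := by
  unfold maxwellian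
  exact Real.contDiff_exp.comp (((contDiff_id.norm_sq ℝ).neg).div_const 2)

theorem contDiff_sqrt_maxwellian {n : WithTop ℕ∞} : ContDiff ℝ n (fun v => √(maxwellian v)) :=
  contDiff_maxwellian.sqrt fun v => (maxwellian_pos v).ne'

theorem measurable_fluxDensity (x : E3) :
    Measurable fun u : E3 => cMu * (maxwellian u * ⟪x, u⟫) := by
  have : Measurable maxwellian := (contDiff_maxwellian (n := 0)).continuous.measurable
  fun_prop

theorem ae_fluxMeasure (x : E3) : ∀ᵐ u ∂fluxMeasure x, 0 < ⟪x, u⟫ :=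
  (withDensity_absolutelyContinuous _ _).ae_le (ae_restrict_mem (measurableSet_halfSpace x))

theorem integral_fluxMeasure (x : E3) (h : E3 → ℝ) :
    ∫ u, h u ∂fluxMeasure x =
      cMu * ∫ u in {u : E3 | 0 < ⟪x, u⟫}, h u * maxwellian u * ⟪x, u⟫ := by
  rw [fluxMeasure, integral_withDensity_eq_integral_toReal_smul
    (measurable_fluxDensity x).ennreal_ofReal (by simp), ← integral_const_mul]
  refine setIntegral_congr_fun (measurableSet_halfSpace x) fun u hu => ?_
  have : 0 ≤ cMu * (maxwellian u * ⟪x, u⟫) :=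
    mul_nonneg cMu_pos.le (mul_nonneg (maxwellian_pos u).le (le_of_lt hu))
  simp only [ENNReal.toReal_ofReal this, smul_eq_mul]
  ring

theorem integrableOn_maxwellian_mul_inner {x : E3} (hx : ‖x‖ = 1) :
    IntegrableOn (fun u => maxwellian u * ⟪x, u⟫) {u : E3 | 0 < ⟪x, u⟫} := by
  -- The integral of a non-integrable function is `0` by convention, which the normalization to `1`
  -- excludes.
  by_contra hi
  have h1 := cMu_mul_integral x hx
  rw [integral_undef hi, mul_zero] at h1
  exact zero_ne_one h1

theorem isProbabilityMeasure_fluxMeasure {x : E3} (hx : ‖x‖ = 1) :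
    IsProbabilityMeasure (fluxMeasure x) := by
  have h1 := cMu_mul_integral x hx
  have hi := integrableOn_maxwellian_mul_inner hx
  constructor
  rw [fluxMeasure, withDensity_apply _ MeasurableSet.univ, Measure.restrict_univ,
    ← ofReal_integral_eq_lintegral_ofReal (hi.const_mul _), integral_const_mul, h1,
    ENNReal.ofReal_one]
  filter_upwards [ae_restrict_mem (measurableSet_halfSpace x)] with u hu
  exact mul_nonneg cMu_pos.le (mul_nonneg (maxwellian_pos u).le (le_of_lt hu))

theorem integral_fluxMeasure_map (R : E3 ≃ₗᵢ[ℝ] E3) (x : E3) (h : E3 → ℝ) :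
    ∫ u, h u ∂fluxMeasure (R x) = ∫ u, h (R u) ∂fluxMeasure x := by
  rw [integral_fluxMeasure, integral_fluxMeasure, ← integral_indicator (measurableSet_halfSpace _),
    ← integral_indicator (measurableSet_halfSpace _),
    ← R.measurePreserving.integral_comp R.toHomeomorph.measurableEmbedding]
  congr 2
  ext u
  simp only [indicator, mem_ofPred_eq, R.inner_map_map, maxwellian, R.norm_map]

theorem exists_isometry_map_eq {x y : E3} (h : ‖x‖ = ‖y‖) : ∃ R : E3 ≃ₗᵢ[ℝ] E3, R x = y :=
  ⟨_, Submodule.reflection_sub h⟩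

/-- The expected discount `e^{-τ}`, where `τ` is the time of flight through the ball. -/
def discount (x : E3) : ℝ := ∫ u, Real.exp (-exitTime x u) ∂fluxMeasure x

theorem discount_eq {x y : E3} (h : ‖x‖ = ‖y‖) : discount x = discount y := by
  obtain ⟨R, rfl⟩ := exists_isometry_map_eq h
  simp only [discount, integral_fluxMeasure_map, exitTime_map]

theorem integral_exp_neg_lt_one {α : Type*} [MeasurableSpace α] (P : Measure α)
    [IsProbabilityMeasure P] {τ : α → ℝ} (hτ : Measurable τ) (h : ∀ᵐ u ∂P, 0 < τ u) :
    Integrable (fun u => Real.exp (-τ u)) P ∧ ∫ u, Real.exp (-τ u) ∂P < 1 := by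
  have hi : Integrable (fun u => Real.exp (-τ u)) P := by
    refine Integrable.of_bound (by fun_prop) 1 ?_
    filter_upwards [h] with u hu
    rw [Real.norm_eq_abs, Real.abs_exp, Real.exp_le_one_iff]
    linarith
  refine ⟨hi, ?_⟩
  have h1 : ∫ _u, (1 : ℝ) ∂P = 1 := by simp
  rw [← h1, ← sub_pos, ← integral_sub (integrable_const _) hi, integral_pos_iff_support_of_nonneg_ae]
  · have : Function.support (fun u => 1 - Real.exp (-τ u)) =ᵐ[P] univ := by
      rw [eventuallyEq_univ]
      filter_upwards [h] with u hu
      have : Real.exp (-τ u) < 1 := by rw [← Real.exp_zero]; exact Real.exp_lt_exp.2 (by linarith)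
      simp only [Function.mem_support]
      linarith
    rw [measure_congr this]
    simp
  · filter_upwards [h] with u hu
    have : Real.exp (-τ u) < 1 := by rw [← Real.exp_zero]; exact Real.exp_lt_exp.2 (by linarith)
    simp only [Pi.zero_apply]
    linarith
  · exact (integrable_const _).sub hi

theorem ae_exitTime_pos {x : E3} (hx : ‖x‖ = 1) : ∀ᵐ u ∂fluxMeasure x, 0 < exitTime x u :=
  (ae_fluxMeasure x).mono fun _ hu => exitTime_pos_outgoing hx hu

/-- Iterating the improvement gives `φ ≤ qⁿ K → 0`. Working with upper bounds avoids suprema. This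
is the contraction argument behind both causality of the renewal solution and uniqueness. -/
theorem nonpos_of_bound_improves {ι : Type*} {φ : ι → ℝ} {q K : ℝ} (hq0 : 0 ≤ q) (hq : q < 1)
    (hK : ∀ i, φ i ≤ K) (h : ∀ S, (∀ i, φ i ≤ S) → ∀ i, φ i ≤ q * S) (i : ι) : φ i ≤ 0 := by
  have h1 : ∀ n : ℕ, ∀ i, φ i ≤ q ^ n * K := fun n => by
    induction n with
    | zero => simpa using hK
    | succ n ih =>
      intro i
      rw [pow_succ', mul_assoc]
      exact h _ ih i
  have h2 : Tendsto (fun n : ℕ => q ^ n * K) atTop (𝓝 0) := by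
    simpa using (tendsto_pow_atTop_nhds_zero_of_lt_one hq0 hq).mul_const K
  exact ge_of_tendsto' h2 fun n => h1 n i

/-! ### The renewal equation. -/

section Renewal

variable {α : Type*} [MeasurableSpace α] (P : Measure α) [IsProbabilityMeasure P] {τ : α → ℝ}

theorem norm_integral_discounted_le (hτ : Measurable τ) (h : ∀ᵐ u ∂P, 0 < τ u) {g : α → ℝ} {S : ℝ}
    (hg : ∀ᵐ u ∂P, ‖g u‖ ≤ S) :
    ‖∫ u, Real.exp (-τ u) * g u ∂P‖ ≤ (∫ u, Real.exp (-τ u) ∂P) * S := by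
  rw [← integral_mul_const]
  refine norm_integral_le_of_norm_le ((integral_exp_neg_lt_one P hτ h).1.mul_const S) ?_
  filter_upwards [hg] with u hu
  rw [norm_mul, Real.norm_eq_abs, Real.abs_exp]
  exact mul_le_mul_of_nonneg_left hu (Real.exp_pos _).le

theorem integrable_discounted (hτ : Measurable τ) (h : ∀ᵐ u ∂P, 0 < τ u) {g : α → ℝ} {S : ℝ}
    (hm : AEStronglyMeasurable g P) (hg : ∀ᵐ u ∂P, ‖g u‖ ≤ S) :
    Integrable (fun u => Real.exp (-τ u) * g u) P :=
  (integral_exp_neg_lt_one P hτ h).1.mul_bdd hm hg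

open BoundedContinuousFunction in
-- Banach's fixed point theorem on bounded continuous functions: the discount `e^{-τ}` with `τ > 0`
-- gives the contraction factor `∫ e^{-τ} < 1`, although `τ` need not be bounded away from `0`.
theorem exists_renewal_discounted (hτ : Measurable τ) (h : ∀ᵐ u ∂P, 0 < τ u) (c : ℝ →ᵇ ℝ) :
    ∃ g : ℝ →ᵇ ℝ, ∀ t, g t = c t + ∫ u, Real.exp (-τ u) * g (t - τ u) ∂P := by
  obtain ⟨hi, hq⟩ := integral_exp_neg_lt_one P hτ h
  set q := ∫ u, Real.exp (-τ u) ∂P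
  have hq0 : 0 ≤ q := integral_nonneg fun u => (Real.exp_pos _).le
  have hm : ∀ (g : ℝ →ᵇ ℝ) t, AEStronglyMeasurable (fun u => g (t - τ u)) P := fun g t =>
    (g.continuous.measurable.comp (measurable_const.sub hτ)).aestronglyMeasurable
  let Φ : (ℝ →ᵇ ℝ) → (ℝ →ᵇ ℝ) := fun g => c + ofNormedAddCommGroup
    (fun t => ∫ u, Real.exp (-τ u) * g (t - τ u) ∂P)
    (by
      refine continuous_of_dominated (bound := fun u => Real.exp (-τ u) * ‖g‖)
        (fun t => (integrable_discounted P hτ h (hm g t)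
          (Eventually.of_forall fun u => g.norm_coe_le_norm _)).aestronglyMeasurable)
        (fun t => Eventually.of_forall fun u => ?_) (hi.mul_const _)
        (Eventually.of_forall fun u => by have := g.continuous; fun_prop)
      rw [norm_mul, Real.norm_eq_abs, Real.abs_exp]
      exact mul_le_mul_of_nonneg_left (g.norm_coe_le_norm _) (Real.exp_pos _).le)
    (q * ‖g‖)
    (fun t => norm_integral_discounted_le P hτ h
      (Eventually.of_forall fun u => g.norm_coe_le_norm _))
  have hΦ : ∀ g t, Φ g t = c t + ∫ u, Real.exp (-τ u) * g (t - τ u) ∂P := fun g t => rfl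
  have hc : ContractingWith (⟨q, hq0⟩ : ℝ≥0) Φ := by
    refine ⟨hq, LipschitzWith.of_dist_le_mul fun g₁ g₂ => ?_⟩
    refine (dist_le (by positivity)).2 fun t => ?_
    rw [hΦ, hΦ, dist_add_left, dist_eq_norm, ← integral_sub
      (integrable_discounted P hτ h (hm g₁ t) (Eventually.of_forall fun u => g₁.norm_coe_le_norm _))
      (integrable_discounted P hτ h (hm g₂ t) (Eventually.of_forall fun u => g₂.norm_coe_le_norm _))]
    simp only [← mul_sub]
    refine norm_integral_discounted_le P hτ h (Eventually.of_forall fun u => ?_)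
    rw [← dist_eq_norm]
    exact dist_coe_le_dist _
  exact ⟨hc.fixedPoint, fun t => by rw [← hΦ, hc.fixedPoint_isFixedPt.eq]⟩

/-- The substitution `k t = e^t g t` turns the equation into the discounted one, with source `e^{-t}
b t`; this source is bounded because `b` vanishes for `t ≤ 0`. -/
theorem exists_renewal_continuous (hτ : Measurable τ) (h : ∀ᵐ u ∂P, 0 < τ u) {b : ℝ → ℝ}
    (hb : Continuous b) {B : ℝ} (hB : ∀ t, ‖b t‖ ≤ B) (hb0 : ∀ t ≤ 0, b t = 0) :
    ∃ k : ℝ → ℝ, Continuous k ∧ (∀ t ≤ 0, k t = 0) ∧ ∀ t, k t = b t + ∫ u, k (t - τ u) ∂P := by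
  obtain ⟨g, hg⟩ := exists_renewal_discounted P hτ h
    (BoundedContinuousFunction.ofNormedAddCommGroup (fun t => Real.exp (-t) * b t)
      (by fun_prop) B fun t => by
        rw [norm_mul, Real.norm_eq_abs, Real.abs_exp]
        rcases le_or_gt t 0 with ht | ht
        · rw [hb0 t ht, norm_zero, mul_zero]
          exact (norm_nonneg _).trans (hB 0)
        · refine (mul_le_of_le_one_left (norm_nonneg _) ?_).trans (hB t)
          rw [Real.exp_le_one_iff]
          linarith)
  simp only [BoundedContinuousFunction.coe_ofNormedAddCommGroup] at hg
  refine ⟨fun t => Real.exp t * g t, by have := g.continuous; fun_prop, fun t ht => ?_, fun t => ?_⟩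
  · obtain ⟨-, hq⟩ := integral_exp_neg_lt_one P hτ h
    -- On `(-∞, 0]` the equation is homogeneous and positive delays stay inside that half-line, so
    -- the contraction forces `g = 0` there.
    have key := nonpos_of_bound_improves (φ := fun s : Iic (0 : ℝ) => ‖g s‖)
      (integral_nonneg fun u => (Real.exp_pos (-τ u)).le) hq (fun s => g.norm_coe_le_norm _)
      (fun S hS s => by
        rw [hg, hb0 _ s.2, mul_zero, zero_add]
        refine norm_integral_discounted_le P hτ h ?_
        filter_upwards [h] with u hu
        exact hS ⟨s - τ u, by have := s.2; simp only [mem_Iic] at *; linarith⟩) ⟨t, ht⟩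
    simp only [norm_le_zero_iff] at key
    change Real.exp t * g t = 0
    rw [key, mul_zero]
  · simp only
    rw [hg, mul_add, ← mul_assoc, ← Real.exp_add, add_neg_cancel, Real.exp_zero, one_mul,
      ← integral_const_mul]
    congr 2
    ext u
    rw [← mul_assoc, ← Real.exp_add, sub_eq_add_neg]

/-- To obtain `m` of class `C¹`, the equation is solved for `m'`, with source `b = a'`, and then
integrated from `0`. -/
theorem exists_renewal (hτ : Measurable τ) (h : ∀ᵐ u ∂P, 0 < τ u) {a b : ℝ → ℝ}
    (hab : ∀ t, HasDerivAt a (b t) t) (hb : Continuous b) {B : ℝ} (hB : ∀ t, ‖b t‖ ≤ B)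
    (ha0 : ∀ t ≤ 0, a t = 0) (hb0 : ∀ t ≤ 0, b t = 0) :
    ∃ m : ℝ → ℝ, ContDiff ℝ 1 m ∧ (∀ t ≤ 0, m t = 0) ∧
      ∀ t, m t = a t + ∫ u, m (t - τ u) ∂P := by
  obtain ⟨k, hk, hk0, hkr⟩ := exists_renewal_continuous P hτ h hb hB hb0
  let m : ℝ → ℝ := fun t => ∫ s in 0..t, k s
  have hmd : ∀ t, HasDerivAt m (k t) t := fun t => hk.integral_hasStrictDerivAt 0 t |>.hasDerivAt
  have hmc : Continuous m := continuous_iff_continuousAt.2 fun t => (hmd t).continuousAt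
  have hm0 : ∀ t ≤ 0, m t = 0 := fun t ht => by
    simp only [m]
    rw [intervalIntegral.integral_symm, neg_eq_zero]
    refine intervalIntegral.integral_zero_ae (Eventually.of_forall fun s hs => hk0 s ?_)
    rw [uIoc_of_le ht] at hs
    exact hs.2
  -- Vanishing on `(-∞, 0]` upgrades the bound on `[0, T]` to one on `(-∞, T]`, which is the
  -- domination needed with unbounded delays.
  have hbd : ∀ {φ : ℝ → ℝ}, Continuous φ → (∀ t ≤ 0, φ t = 0) → ∀ T, ∃ C, 0 ≤ C ∧
      ∀ t ≤ T, ‖φ t‖ ≤ C := fun {φ} hφ h0 T => by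
    obtain ⟨C, hC⟩ := isCompact_Icc.exists_bound_of_continuousOn (s := Icc 0 T) hφ.continuousOn
    refine ⟨max C 0, le_max_right _ _, fun t ht => ?_⟩
    rcases le_or_gt t 0 with h | h
    · rw [h0 t h, norm_zero]
      exact le_max_right _ _
    · exact (hC t ⟨h.le, ht⟩).trans (le_max_left _ _)
  have hLd : ∀ t, HasDerivAt (fun t => ∫ u, m (t - τ u) ∂P) (∫ u, k (t - τ u) ∂P) t := fun t => by
    obtain ⟨C, -, hC⟩ := hbd hk hk0 (t + 1)
    obtain ⟨C', -, hC'⟩ := hbd hmc hm0 t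
    have hms : ∀ {φ : ℝ → ℝ}, Continuous φ → ∀ t,
        AEStronglyMeasurable (fun u => φ (t - τ u)) P := fun hφ t =>
      (hφ.measurable.comp (measurable_const.sub hτ)).aestronglyMeasurable
    refine (hasDerivAt_integral_of_dominated_loc_of_deriv_le (bound := fun _ => C)
      (F := fun t u => m (t - τ u)) (F' := fun t u => k (t - τ u)) (Iio_mem_nhds (lt_add_one t)) (Eventually.of_forall (hms hmc))
      (Integrable.of_bound (hms hmc t) C' ?_) (hms hk t) ?_ (integrable_const _) ?_).2
    · filter_upwards [h] with u hu
      exact hC' _ (by linarith)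
    · filter_upwards [h] with u hu s hs
      exact hC _ (by rw [mem_Iio] at hs; linarith)
    · exact Eventually.of_forall fun u s _ => (hmd _).comp_sub_const s (τ u)
  refine ⟨m, ?_, hm0, fun t => ?_⟩
  · refine contDiff_one_iff_deriv.2 ⟨fun t => (hmd t).differentiableAt, ?_⟩
    rwa [funext fun t => (hmd t).deriv]
  -- Both sides of the renewal equation have the same derivative and both vanish at `0`.
  · have hd : ∀ t, HasDerivAt (fun t => m t - (a t + ∫ u, m (t - τ u) ∂P)) 0 t := fun t => by
      have := (hmd t).sub ((hab t).add (hLd t))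
      rwa [← hkr, sub_self] at this
    have h1 := is_const_of_deriv_eq_zero (fun t => (hd t).differentiableAt)
      (fun t => (hd t).deriv) t 0
    have h2 : ∫ u, m (0 - τ u) ∂P = 0 := integral_eq_zero_of_ae <| by
      filter_upwards [h] with u hu
      exact hm0 _ (by linarith)
    simp only [h2, hm0 0 le_rfl, ha0 0 le_rfl] at h1
    linarith

end Renewal

/-! ### The source term `a` of the renewal equation. -/

theorem IsDatum.notMem_tsupport {G : E3 → E3 → ℝ} (hG : IsDatum G) {x v : E3} (h : 1 ≤ ‖x‖ ∨ 1 ≤ ‖v‖) :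
    (x, v) ∉ tsupport (fun p : E3 × E3 => G p.1 p.2) := fun hp => by
  have := hG.support hp
  simp only [mem_prod, mem_ball_zero_iff] at this
  rcases h with h | h <;> linarith [this.1, this.2]

theorem one_le_norm_sub_smul {x v : E3} {t : ℝ} (hx : ‖x‖ = 1) (h : t * ⟪x, v⟫ ≤ 0) :
    1 ≤ ‖x - t • v‖ := by
  have h1 := norm_sub_sq_real x (t • v)
  rw [inner_smul_right, hx] at h1
  nlinarith [norm_nonneg (x - t • v), sq_nonneg ‖t • v‖]

/-- Differentiation under the integral. The factor `-u` in the derivative is harmless because the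
data vanish for `|u| ≥ 1`. For `t ≤ 0` and outgoing `u`, the point `e - tu` is outside the open
ball, hence outside the support. -/
theorem IsDatum.hasDerivAt_source {G : E3 → E3 → ℝ} (hG : IsDatum G) {e : E3} (he : ‖e‖ = 1) :
    ∃ (b : ℝ → ℝ) (B : ℝ),
      (∀ t, HasDerivAt (fun t => ∫ u, G (e - t • u) u ∂fluxMeasure e) (b t) t) ∧
      Continuous b ∧ (∀ t, ‖b t‖ ≤ B) ∧
      (∀ t ≤ (0 : ℝ), ∫ u, G (e - t • u) u ∂fluxMeasure e = 0) ∧ ∀ t ≤ 0, b t = 0 := by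
  have := isProbabilityMeasure_fluxMeasure he
  set H : E3 × E3 → ℝ := fun p => G p.1 p.2
  have hH1 : Differentiable ℝ H := hG.smooth.differentiable (by simp)
  have hH2 : Continuous (fderiv ℝ H) := hG.smooth.continuous_fderiv (by simp)
  obtain ⟨C₀, hC₀⟩ := hH1.continuous.bounded_above_of_compact_support hG.compact
  obtain ⟨C, hC⟩ := hH2.bounded_above_of_compact_support (hG.compact.fderiv ℝ)
  have hfd : ∀ (t : ℝ) (u : E3), HasDerivAt (fun t : ℝ => H (e - t • u, u))
      (fderiv ℝ H (e - t • u, u) (-u, 0)) t := fun t u => by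
    have h1 : HasDerivAt (fun t : ℝ => ((e - t • u, u) : E3 × E3)) (-u, 0) t := by
      have := (((hasDerivAt_id t).smul_const u).const_sub e)
      rw [one_smul] at this
      exact this.prodMk (hasDerivAt_const t u)
    exact (hH1 _).hasFDerivAt.comp_hasDerivAt t h1
  have hbd : ∀ (t : ℝ) (u : E3), ‖fderiv ℝ H (e - t • u, u) (-u, 0)‖ ≤ C := fun t u => by
    by_cases hu : 1 ≤ ‖u‖
    · rw [image_eq_zero_of_notMem_tsupport
        (fun h => hG.notMem_tsupport (Or.inr hu) (tsupport_fderiv_subset ℝ h))]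
      simpa using (norm_nonneg _).trans (hC 0)
    · refine (ContinuousLinearMap.le_opNorm _ _).trans ?_
      have : ‖((-u, 0) : E3 × E3)‖ ≤ 1 := by
        simp only [Prod.norm_mk, norm_neg, norm_zero]
        exact max_le (not_le.1 hu).le zero_le_one
      exact (mul_le_of_le_one_right (norm_nonneg _) this).trans (hC _)
  have hct : ∀ u : E3, Continuous fun t : ℝ => fderiv ℝ H (e - t • u, u) (-u, 0) := fun u => by
    have : Continuous fun t : ℝ => ((e - t • u, u) : E3 × E3) := by fun_prop
    exact (hH2.comp this).clm_apply continuous_const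
  have hcu : ∀ t : ℝ, Continuous fun u : E3 => fderiv ℝ H (e - t • u, u) (-u, 0) := fun t => by
    have : Continuous fun u : E3 => ((e - t • u, u) : E3 × E3) := by fun_prop
    exact (hH2.comp this).clm_apply (by fun_prop)
  have hcu' : ∀ t : ℝ, Continuous fun u : E3 => H (e - t • u, u) := fun t =>
    hH1.continuous.comp (by fun_prop)
  have hout : ∀ t ≤ (0 : ℝ), ∀ᵐ u ∂fluxMeasure e, (e - t • u, u) ∉ tsupport H := fun t ht => by
    filter_upwards [ae_fluxMeasure e] with u hu
    exact hG.notMem_tsupport (Or.inl (one_le_norm_sub_smul he (mul_nonpos_of_nonpos_of_nonneg ht hu.le)))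
  refine ⟨fun t => ∫ u, fderiv ℝ H (e - t • u, u) (-u, 0) ∂fluxMeasure e, C, fun t => ?_, ?_,
    fun t => ?_, fun t ht => ?_, fun t ht => ?_⟩
  · exact (hasDerivAt_integral_of_dominated_loc_of_deriv_le (bound := fun _ => C)
      (F := fun (t : ℝ) u => H (e - t • u, u))
      (F' := fun (t : ℝ) u => fderiv ℝ H (e - t • u, u) (-u, 0)) univ_mem
      (Eventually.of_forall fun t => (hcu' t).aestronglyMeasurable)
      (Integrable.of_bound (hcu' t).aestronglyMeasurable C₀ (Eventually.of_forall fun u => hC₀ _))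
      (hcu t).aestronglyMeasurable (Eventually.of_forall fun u t _ => hbd t u)
      (integrable_const _) (Eventually.of_forall fun u t _ => hfd t u)).2
  · exact continuous_of_dominated (bound := fun _ => C)
      (fun t => (hcu t).aestronglyMeasurable) (fun t => Eventually.of_forall fun u => hbd t u)
      (integrable_const _) (Eventually.of_forall hct)
  · simpa using norm_integral_le_of_norm_le_const (μ := fluxMeasure e)
      (Eventually.of_forall fun u => hbd t u)
  · refine integral_eq_zero_of_ae ?_
    filter_upwards [hout t ht] with u hu
    exact image_eq_zero_of_notMem_tsupport (f := H) hu
  · refine integral_eq_zero_of_ae ?_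
    filter_upwards [hout t ht] with u hu
    rw [image_eq_zero_of_notMem_tsupport (fun h => hu (tsupport_fderiv_subset ℝ h))]
    rfl

/-! ### The explicit solution. -/

/-- The solution with initial datum `√μ G` and boundary flux `m`. -/
def transportSol (G : E3 → E3 → ℝ) (m : ℝ → ℝ) (t : ℝ) (x v : E3) : ℝ :=
  -- Both terms are kept at all times: `G` vanishes outside the ball and `m` will vanish before time
  -- `0`. The case `v = 0` is separate because `exitTime x 0 = 0` by the convention for division by
  -- zero, whereas a particle at rest never meets the boundary.
  √(maxwellian v) * (G (x - t • v) v + if v = 0 then 0 else m (t - exitTime x v))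

/-- The formula is `C¹` on a full neighbourhood, even at boundary points, because the discriminant
stays positive off the grazing set. The gradients are therefore their own traces. -/
theorem contDiffAt_transportSol {G : E3 → E3 → ℝ} (hG : IsDatum G) {m : ℝ → ℝ}
    (hm : ContDiff ℝ 1 m) (hm0 : ∀ t ≤ 0, m t = 0) (t : ℝ) {x v : E3}
    (h : (x, v) ∈ phaseOffGrazing) :
    ContDiffAt ℝ 1 (fun q : ℝ × E3 × E3 => transportSol G m q.1 q.2.1 q.2.2) (t, x, v) := by
  have h1 : ContDiff ℝ 1 fun q : ℝ × E3 × E3 => √(maxwellian q.2.2) :=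
    contDiff_sqrt_maxwellian.comp (contDiff_snd.comp contDiff_snd)
  have h2 : ContDiff ℝ 1 fun q : ℝ × E3 × E3 => G (q.2.1 - q.1 • q.2.2) q.2.2 :=
    (hG.smooth.of_le (by exact_mod_cast le_top)).comp (g := fun p : E3 × E3 => G p.1 p.2)
      (f := fun q : ℝ × E3 × E3 => (q.2.1 - q.1 • q.2.2, q.2.2))
      (by fun_prop)
  refine h1.contDiffAt.mul (h2.contDiffAt.add ?_)
  by_cases hv : v = 0
  -- Near `v = 0` the point `x - tv` is still in the ball, so the exit time is at least `t` and the
  -- `m` term vanishes.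
  · refine (contDiffAt_const (c := (0 : ℝ))).congr_of_eventuallyEq ?_
    have hx : ‖x‖ < 1 := by
      subst hv
      exact lt_of_le_of_ne h.1 fun h' => h.2 ⟨h', by simp⟩
    have hc : ContinuousAt (fun q : ℝ × E3 × E3 => ‖q.2.1 - q.1 • q.2.2‖) (t, x, v) := by
      fun_prop
    have := hc.eventually_lt_const (u := 1) (by simpa [hv] using hx)
    filter_upwards [this] with q hq
    split_ifs with h0
    · rfl
    · exact hm0 _ (sub_nonpos.2 (le_exitTime h0 hq.le))
  · have h3 : ContDiffAt ℝ 1 (fun q : ℝ × E3 × E3 => m (q.1 - exitTime q.2.1 q.2.2)) (t, x, v) :=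
      hm.contDiffAt.comp (t, x, v) (contDiff_fst.contDiffAt.sub
        ((contDiffAt_exitTime (p := (x, v)) hv (exitDisc_pos h hv).ne').comp (t, x, v)
          contDiff_snd.contDiffAt))
    refine h3.congr_of_eventuallyEq ?_
    have hc : ContinuousAt (fun q : ℝ × E3 × E3 => q.2.2) (t, x, v) := by fun_prop
    filter_upwards [hc.eventually_ne hv] with q hq
    rw [if_neg hq]

theorem hasFDerivAt_slice_x {f : ℝ → E3 → E3 → ℝ} {t : ℝ} {x v : E3}
    (h : DifferentiableAt ℝ (fun q : ℝ × E3 × E3 => f q.1 q.2.1 q.2.2) (t, x, v)) :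
    HasFDerivAt (fun y => f t y v)
      ((fderiv ℝ (fun q : ℝ × E3 × E3 => f q.1 q.2.1 q.2.2) (t, x, v)).comp
        ((ContinuousLinearMap.inr ℝ ℝ (E3 × E3)).comp (ContinuousLinearMap.inl ℝ E3 E3))) x :=
  have h1 : HasFDerivAt (fun y : E3 => ((t, y, v) : ℝ × E3 × E3))
      ((ContinuousLinearMap.inr ℝ ℝ (E3 × E3)).comp (ContinuousLinearMap.inl ℝ E3 E3)) x :=
    HasFDerivAt.comp (g := fun p : E3 × E3 => (t, p)) x (hasFDerivAt_prodMk_right t (x, v))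
      (hasFDerivAt_prodMk_left x v)
  HasFDerivAt.comp (g := fun q : ℝ × E3 × E3 => f q.1 q.2.1 q.2.2) x h.hasFDerivAt h1

theorem hasFDerivAt_slice_v {f : ℝ → E3 → E3 → ℝ} {t : ℝ} {x v : E3}
    (h : DifferentiableAt ℝ (fun q : ℝ × E3 × E3 => f q.1 q.2.1 q.2.2) (t, x, v)) :
    HasFDerivAt (fun w => f t x w)
      ((fderiv ℝ (fun q : ℝ × E3 × E3 => f q.1 q.2.1 q.2.2) (t, x, v)).comp
        ((ContinuousLinearMap.inr ℝ ℝ (E3 × E3)).comp (ContinuousLinearMap.inr ℝ E3 E3))) v :=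
  have h1 : HasFDerivAt (fun y : E3 => ((t, x, y) : ℝ × E3 × E3))
      ((ContinuousLinearMap.inr ℝ ℝ (E3 × E3)).comp (ContinuousLinearMap.inr ℝ E3 E3)) v :=
    HasFDerivAt.comp (g := fun p : E3 × E3 => (t, p)) v (hasFDerivAt_prodMk_right t (x, v))
      (hasFDerivAt_prodMk_right x v)
  HasFDerivAt.comp (g := fun q : ℝ × E3 × E3 => f q.1 q.2.1 q.2.2) v h.hasFDerivAt h1

theorem inner_gradX {f : ℝ → E3 → E3 → ℝ} {t : ℝ} {x v : E3}
    (h : DifferentiableAt ℝ (fun q : ℝ × E3 × E3 => f q.1 q.2.1 q.2.2) (t, x, v)) (w : E3) :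
    ⟪w, gradX f t x v⟫ =
      fderiv ℝ (fun q : ℝ × E3 × E3 => f q.1 q.2.1 q.2.2) (t, x, v) (0, w, 0) := by
  rw [real_inner_comm, gradX, gradient, InnerProductSpace.toDual_symm_apply,
    (hasFDerivAt_slice_x h).fderiv]
  rfl

theorem continuousAt_gradX {f : ℝ → E3 → E3 → ℝ} {t : ℝ} {x v : E3}
    (h : ContDiffAt ℝ 1 (fun q : ℝ × E3 × E3 => f q.1 q.2.1 q.2.2) (t, x, v)) :
    ContinuousAt (fun q : ℝ × E3 × E3 => gradX f q.1 q.2.1 q.2.2) (t, x, v) := by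
  have h1 := h.continuousAt_fderiv (by simp)
  refine ContinuousAt.congr (f := fun q => (InnerProductSpace.toDual ℝ E3).symm
    ((fderiv ℝ (fun q : ℝ × E3 × E3 => f q.1 q.2.1 q.2.2) q).comp
        ((ContinuousLinearMap.inr ℝ ℝ (E3 × E3)).comp (ContinuousLinearMap.inl ℝ E3 E3)))) ?_ ?_
  · exact (InnerProductSpace.toDual ℝ E3).symm.continuous.continuousAt.comp
      (h1.clm_comp continuousAt_const)
  · filter_upwards [h.eventually (by simp)] with q hq
    rw [gradX, gradient, (hasFDerivAt_slice_x (hq.differentiableAt (by simp))).fderiv]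

theorem continuousAt_gradV {f : ℝ → E3 → E3 → ℝ} {t : ℝ} {x v : E3}
    (h : ContDiffAt ℝ 1 (fun q : ℝ × E3 × E3 => f q.1 q.2.1 q.2.2) (t, x, v)) :
    ContinuousAt (fun q : ℝ × E3 × E3 => gradV f q.1 q.2.1 q.2.2) (t, x, v) := by
  have h1 := h.continuousAt_fderiv (by simp)
  refine ContinuousAt.congr (f := fun q => (InnerProductSpace.toDual ℝ E3).symm
    ((fderiv ℝ (fun q : ℝ × E3 × E3 => f q.1 q.2.1 q.2.2) q).comp
        ((ContinuousLinearMap.inr ℝ ℝ (E3 × E3)).comp (ContinuousLinearMap.inr ℝ E3 E3)))) ?_ ?_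
  · exact (InnerProductSpace.toDual ℝ E3).symm.continuous.continuousAt.comp
      (h1.clm_comp continuousAt_const)
  · filter_upwards [h.eventually (by simp)] with q hq
    rw [gradV, gradient, (hasFDerivAt_slice_v (hq.differentiableAt (by simp))).fderiv]

theorem isTrace_transportSol {G : E3 → E3 → ℝ} (hG : IsDatum G) {m : ℝ → ℝ}
    (hm : ContDiff ℝ 1 m) (hm0 : ∀ t ≤ 0, m t = 0) :
    IsTrace (gradX (transportSol G m)) (gradX (transportSol G m)) ∧
      IsTrace (gradV (transportSol G m)) (gradV (transportSol G m)) :=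
  ⟨fun t _ _ _ hx hv => ((continuousAt_gradX
      (contDiffAt_transportSol hG hm hm0 t ⟨hx.le, fun h => hv h.2⟩)).tendsto).mono_left
        nhdsWithin_le_nhds,
    fun t _ _ _ hx hv => ((continuousAt_gradV
      (contDiffAt_transportSol hG hm hm0 t ⟨hx.le, fun h => hv h.2⟩)).tendsto).mono_left
        nhdsWithin_le_nhds⟩

theorem transportSol_add (G : E3 → E3 → ℝ) (m : ℝ → ℝ) (t : ℝ) (x v : E3) (s : ℝ) :
    transportSol G m (t + s) (x + s • v) v = transportSol G m t x v := by
  unfold transportSol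
  congr 2
  · congr 1
    rw [add_smul]
    abel
  · split_ifs with h
    · rfl
    · rw [exitTime_add_smul h, add_sub_add_right_eq_sub]

theorem mem_phaseOffGrazing_of_mem_Omega {x : E3} (hx : x ∈ Omega) (v : E3) :
    (x, v) ∈ phaseOffGrazing := by
  rw [Omega, mem_ball_zero_iff] at hx
  exact ⟨hx.le, fun h => hx.ne h.1⟩

theorem integrable_transport_terms {G : E3 → E3 → ℝ} (hG : IsDatum G) {m : ℝ → ℝ}
    (hm : Continuous m) (hm0 : ∀ t ≤ 0, m t = 0) (t : ℝ) {x : E3} (hx : ‖x‖ = 1) :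
    Integrable (fun u => G (x - t • u) u) (fluxMeasure x) ∧
      Integrable (fun u => m (t - exitTime x u)) (fluxMeasure x) := by
  have := isProbabilityMeasure_fluxMeasure hx
  have hc := hG.smooth.continuous
  obtain ⟨C₀, hC₀⟩ := hc.bounded_above_of_compact_support hG.compact
  obtain ⟨C, hC⟩ := isCompact_Icc.exists_bound_of_continuousOn (s := Icc 0 t) hm.continuousOn
  constructor
  · exact Integrable.of_bound (hc.comp (g := fun p : E3 × E3 => G p.1 p.2)
      (f := fun u => (x - t • u, u)) (by fun_prop)).aestronglyMeasurable C₀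
      (Eventually.of_forall fun u => hC₀ (x - t • u, u))
  · refine Integrable.of_bound (hm.measurable.comp (measurable_const.sub
      (measurable_exitTime x))).aestronglyMeasurable (max C 0) ?_
    filter_upwards [ae_exitTime_pos hx] with u hu
    rcases le_or_gt (t - exitTime x u) 0 with h | h
    · simp [hm0 _ h]
    · exact (hC _ ⟨h.le, by linarith⟩).trans (le_max_left _ _)

theorem hasDerivAt_characteristic {f : ℝ → E3 → E3 → ℝ} {t : ℝ} {x v y : E3}
    (hd : DifferentiableAt ℝ (fun q : ℝ × E3 × E3 => f q.1 q.2.1 q.2.2) (t, x, v))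
    (hy : y + t • v = x) :
    HasDerivAt (fun s => f s (y + s • v) v) (deriv (fun s => f s x v) t + ⟪v, gradX f t x v⟫) t := by
  rw [inner_gradX hd]
  have hl := hd.hasFDerivAt
  set L := fderiv ℝ (fun q : ℝ × E3 × E3 => f q.1 q.2.1 q.2.2) (t, x, v)
  have h1 : HasDerivAt (fun s => f s x v) (L (1, 0)) t :=
    HasFDerivAt.comp_hasDerivAt (l := fun q : ℝ × E3 × E3 => f q.1 q.2.1 q.2.2)
      (f := fun s : ℝ => (s, x, v)) t hl ((hasDerivAt_id t).prodMk (hasDerivAt_const t (x, v)))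
  have h3 : HasDerivAt (fun s : ℝ => ((s, y + s • v, v) : ℝ × E3 × E3)) (1, v, 0) t := by
    have h4 := ((hasDerivAt_id t).smul_const v).const_add y
    rw [one_smul] at h4
    exact (hasDerivAt_id t).prodMk (h4.prodMk (hasDerivAt_const _ v))
  have h2 : HasDerivAt (fun s => f s (y + s • v) v) (L (1, v, 0)) t :=
    HasFDerivAt.comp_hasDerivAt_of_eq (l := fun q : ℝ × E3 × E3 => f q.1 q.2.1 q.2.2)
      (f := fun s : ℝ => (s, y + s • v, v)) t hl h3 (by rw [hy])
  rw [h1.deriv, ← map_add]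
  simpa using h2

theorem transportSol_transport {G : E3 → E3 → ℝ} (hG : IsDatum G) {m : ℝ → ℝ}
    (hm : ContDiff ℝ 1 m) (hm0 : ∀ t ≤ 0, m t = 0) (t : ℝ) {x v : E3}
    (hp : (x, v) ∈ phaseOffGrazing) :
    deriv (fun s => transportSol G m s x v) t + ⟪v, gradX (transportSol G m) t x v⟫ = 0 := by
  have hd := (contDiffAt_transportSol hG hm hm0 t hp).differentiableAt (by simp)
  have h1 := hasDerivAt_characteristic hd (sub_add_cancel x (t • v))
  have h2 : (fun s => transportSol G m s (x - t • v + s • v) v) =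
      fun _ => transportSol G m 0 (x - t • v) v := funext fun s => by
    simpa using transportSol_add G m 0 (x - t • v) v s
  rw [h2] at h1
  exact h1.unique (hasDerivAt_const _ _)

/-- A rotation moves `x` to the reference point `e`, where the renewal equation identifies the
outgoing flux with `m t`. On the incoming side the exit time is `0` and the `G` term is off its
support, so only `√μ m(t)` remains. -/
theorem transportSol_diffuse {G : E3 → E3 → ℝ} (hG : IsDatum G)
    (hrot : ∀ (R : E3 ≃ₗᵢ[ℝ] E3) x v, G (R x) (R v) = G x v) {m : ℝ → ℝ}
    (hm : Continuous m) (hm0 : ∀ t ≤ 0, m t = 0) {e : E3} (he : ‖e‖ = 1)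
    (hr : ∀ t, m t = ∫ u, G (e - t • u) u ∂fluxMeasure e +
      ∫ u, m (t - exitTime e u) ∂fluxMeasure e) {t : ℝ} (ht : 0 ≤ t) {x v : E3} (hx : ‖x‖ = 1)
    (hxv : ⟪x, v⟫ < 0) :
    transportSol G m t x v = cMu * √(maxwellian v) *
      ∫ u in {u : E3 | 0 < ⟪x, u⟫}, transportSol G m t x u * √(maxwellian u) * ⟪x, u⟫ := by
  obtain ⟨R, rfl⟩ := exists_isometry_map_eq (he.trans hx.symm)
  have h1 : ∫ u in {u : E3 | 0 < ⟪R e, u⟫},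
      transportSol G m t (R e) u * √(maxwellian u) * ⟪R e, u⟫ =
      ∫ u in {u : E3 | 0 < ⟪R e, u⟫},
        (G (R e - t • u) u + m (t - exitTime (R e) u)) * maxwellian u * ⟪R e, u⟫ := by
    refine setIntegral_congr_fun (measurableSet_halfSpace _) fun u hu => ?_
    simp only [mem_ofPred_eq] at hu
    simp only [transportSol]
    rw [if_neg (ne_zero_of_inner_ne_zero hu.ne')]
    nth_rewrite 3 [← Real.mul_self_sqrt (maxwellian_pos u).le]
    ring
  obtain ⟨hi1, hi2⟩ := integrable_transport_terms hG hm hm0 t hx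
  rw [h1, mul_comm cMu, mul_assoc, ← integral_fluxMeasure, integral_add hi1 hi2,
    integral_fluxMeasure_map, integral_fluxMeasure_map]
  simp only [exitTime_map, ← map_smul, ← map_sub, hrot]
  rw [← hr, transportSol, if_neg (ne_zero_of_inner_ne_zero hxv.ne), exitTime_incoming hx hxv,
    sub_zero, image_eq_zero_of_notMem_tsupport (f := fun p : E3 × E3 => G p.1 p.2)
      (x := (R e - t • v, v)) (hG.notMem_tsupport (Or.inl (one_le_norm_sub_smul hx
        (mul_nonpos_of_nonneg_of_nonpos ht hxv.le)))), zero_add]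

theorem isSolution_transportSol {G : E3 → E3 → ℝ} (hG : IsDatum G)
    (hrot : ∀ (R : E3 ≃ₗᵢ[ℝ] E3) x v, G (R x) (R v) = G x v) {m : ℝ → ℝ}
    (hm : ContDiff ℝ 1 m) (hm0 : ∀ t ≤ 0, m t = 0) {e : E3} (he : ‖e‖ = 1)
    (hr : ∀ t, m t = ∫ u, G (e - t • u) u ∂fluxMeasure e +
      ∫ u, m (t - exitTime e u) ∂fluxMeasure e) :
    IsSolution (fun x v => √(maxwellian v) * G x v) (transportSol G m) where
  continuousOn := fun q hq =>
    (contDiffAt_transportSol hG hm hm0 q.1 hq.2).continuousAt.continuousWithinAt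
  bounded := fun T => by
    obtain ⟨C₀, hC₀⟩ := hG.smooth.continuous.bounded_above_of_compact_support hG.compact
    obtain ⟨C, hC⟩ := isCompact_Icc.exists_bound_of_continuousOn (s := Icc 0 T)
      hm.continuous.continuousOn
    refine ⟨1 * (C₀ + max C 0), fun t ht p hp => ?_⟩
    unfold transportSol
    rw [abs_mul]
    refine mul_le_mul ?_ ((abs_add_le _ _).trans (add_le_add (hC₀ (p.1 - t • p.2, p.2)) ?_))
      (abs_nonneg _) zero_le_one
    · rw [abs_of_nonneg (Real.sqrt_nonneg _), Real.sqrt_le_one, maxwellian,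
        Real.exp_le_one_iff]
      nlinarith [sq_nonneg ‖p.2‖]
    · split_ifs with h
      · simp
      · have h1 := exitTime_nonneg hp.1 p.2
        rcases le_or_gt (t - exitTime p.1 p.2) 0 with h | h
        · simp [hm0 _ h]
        · exact (hC _ ⟨h.le, by linarith [ht.2]⟩).trans (le_max_left _ _)
  contDiffOn := fun q hq => (contDiffAt_transportSol hG hm hm0 q.1
    (mem_phaseOffGrazing_of_mem_Omega hq.2.1 q.2.2)).contDiffWithinAt
  transport := fun t _ x hx v =>
    transportSol_transport hG hm hm0 t (mem_phaseOffGrazing_of_mem_Omega hx v)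
  initial := fun x hx v => by
    rw [Omega, mem_ball_zero_iff] at hx
    unfold transportSol
    rw [zero_smul, sub_zero]
    split_ifs
    · rw [add_zero]
    · rw [hm0 _ (by linarith [exitTime_nonneg hx.le v]), add_zero]
  diffuse := fun t ht x v hx hxv =>
    transportSol_diffuse hG hrot hm.continuous hm0 he hr ht hx hxv

/-! ### Uniqueness of solutions. -/

section Uniqueness

variable {f₀ : E3 → E3 → ℝ} {f g : ℝ → E3 → E3 → ℝ}

/-- Mean value theorem along the characteristic: the equation is needed only on the open segment,
while continuity off the grazing set handles endpoints on the boundary or at time `0`. -/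
theorem IsSolution.eq_along_characteristic (hf : IsSolution f₀ f) {t r : ℝ} (hr : 0 ≤ r)
    (hrt : r ≤ t) {x v : E3} (h0 : (x, v) ∈ phaseOffGrazing)
    (h1 : (x - r • v, v) ∈ phaseOffGrazing) (h : ∀ s ∈ Ioo 0 r, x - s • v ∈ Omega) :
    f t x v = f (t - r) (x - r • v) v := by
  rcases hr.eq_or_lt with rfl | hr
  · simp
  have hmem : ∀ s ∈ Icc (t - r) t, (x - t • v + s • v, v) ∈ phaseOffGrazing := fun s hs => by
    have hx : x - t • v + s • v = x - (t - s) • v := by rw [sub_smul]; abel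
    rw [hx]
    rcases hs.2.eq_or_lt with rfl | h2
    · simpa using h0
    rcases hs.1.eq_or_lt with rfl | h3
    · simpa using h1
    exact mem_phaseOffGrazing_of_mem_Omega (h _ ⟨by linarith, by linarith⟩) v
  have hc : ContinuousOn (fun s => f s (x - t • v + s • v) v) (Icc (t - r) t) :=
    hf.continuousOn.comp (f := fun s : ℝ => (s, x - t • v + s • v, v)) (by fun_prop)
      fun s hs => ⟨by have := hs.1; simp only [mem_Ici]; linarith, hmem s hs⟩
  have hd : ∀ s ∈ Ioo (t - r) t, HasDerivAt (fun s => f s (x - t • v + s • v) v) 0 s :=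
    fun s hs => by
    have hx : x - t • v + s • v = x - (t - s) • v := by rw [sub_smul]; abel
    have hO : x - t • v + s • v ∈ Omega := by
      rw [hx]
      exact h _ ⟨by linarith [hs.2], by linarith [hs.1]⟩
    have hs0 : 0 < s := by linarith [hs.1]
    have hopen : IsOpen (Ioi (0 : ℝ) ×ˢ Omega ×ˢ (univ : Set E3)) :=
      isOpen_Ioi.prod (Metric.isOpen_ball.prod isOpen_univ)
    have hda := (hf.contDiffOn.contDiffAt (x := (s, x - t • v + s • v, v))
      (hopen.mem_nhds ⟨hs0, hO, mem_univ _⟩)).differentiableAt (by simp)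
    have := hasDerivAt_characteristic hda rfl
    rwa [hf.transport s hs0 _ hO] at this
  obtain ⟨c, hc', hcs⟩ := exists_hasDerivAt_eq_slope _ (fun _ => (0 : ℝ)) (by linarith) hc hd
  rw [eq_comm, div_eq_zero_iff] at hcs
  rcases hcs with hcs | hcs
  · have hx : x - t • v + (t - r) • v = x - r • v := by rw [sub_smul]; abel
    rw [hx, sub_add_cancel] at hcs
    linarith
  · linarith

theorem IsSolution.continuousOn_time (hf : IsSolution f₀ f) {x v : E3}
    (h : (x, v) ∈ phaseOffGrazing) : ContinuousOn (fun t => f t x v) (Ici 0) :=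
  hf.continuousOn.comp (f := fun s : ℝ => (s, x, v)) (by fun_prop) fun _ hs => ⟨hs, h⟩

theorem eq_at_zero_of_eventually_eq {φ ψ : ℝ → ℝ} (hφ : ContinuousOn φ (Ici 0))
    (hψ : ContinuousOn ψ (Ici 0)) (h : ∀ᶠ t in 𝓝[>] 0, φ t = ψ t) : φ 0 = ψ 0 := by
  have h1 := ((hφ 0 self_mem_Ici).tendsto).mono_left (nhdsWithin_mono 0 Ioi_subset_Ici_self)
  have h2 := ((hψ 0 self_mem_Ici).tendsto).mono_left (nhdsWithin_mono 0 Ioi_subset_Ici_self)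
  exact tendsto_nhds_unique_of_eventuallyEq h1 h2 h

theorem IsSolution.eq_before_exit (hf : IsSolution f₀ f) (hg : IsSolution f₀ g) {t : ℝ}
    (ht : 0 ≤ t) {x v : E3} (h : (x, v) ∈ phaseOffGrazing) (hv : v ≠ 0) (hτ : t < exitTime x v) :
    f t x v = g t x v := by
  have hpos : ∀ s, 0 < s → s < exitTime x v → f s x v = g s x v := fun s hs hsτ => by
    have hO : ∀ r ∈ Ioo 0 (exitTime x v), x - r • v ∈ Omega := fun r hr => by
      rw [Omega, mem_ball_zero_iff]
      exact norm_sub_smul_lt_one h.1 hv hr.1 hr.2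
    have h1 := mem_phaseOffGrazing_of_mem_Omega (hO s ⟨hs, hsτ⟩) v
    have h2 : ∀ r ∈ Ioo 0 s, x - r • v ∈ Omega := fun r hr => hO r ⟨hr.1, hr.2.trans hsτ⟩
    rw [hf.eq_along_characteristic hs.le le_rfl h h1 h2,
      hg.eq_along_characteristic hs.le le_rfl h h1 h2, sub_self, hf.initial _ (hO s ⟨hs, hsτ⟩),
      hg.initial _ (hO s ⟨hs, hsτ⟩)]
  rcases ht.eq_or_lt with rfl | ht
  -- The initial condition is imposed only inside the ball; at boundary points it is recovered by
  -- letting the time tend to `0`.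
  · refine eq_at_zero_of_eventually_eq (hf.continuousOn_time h) (hg.continuousOn_time h) ?_
    filter_upwards [Ioo_mem_nhdsGT hτ] with s hs
    exact hpos s hs.1 hs.2
  · exact hpos t ht hτ

theorem IsSolution.eq_at_exit (hf : IsSolution f₀ f) {t : ℝ} {x v : E3}
    (h : (x, v) ∈ phaseOffGrazing) (hv : v ≠ 0) (hτ : exitTime x v ≤ t) :
    f t x v = f (t - exitTime x v) (x - exitTime x v • v) v ∧ ‖x - exitTime x v • v‖ = 1 ∧
      ⟪x - exitTime x v • v, v⟫ < 0 := by
  have h1 := norm_sub_exitTime_smul h.1 hv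
  have h2 : ⟪x - exitTime x v • v, v⟫ < 0 := by
    rw [inner_sub_exitTime_smul hv, neg_lt_zero]
    exact Real.sqrt_pos.2 (exitDisc_pos h hv)
  refine ⟨hf.eq_along_characteristic (exitTime_nonneg h.1 v) hτ h
    ⟨h1.le, fun h3 => h2.ne h3.2⟩ fun r hr => ?_, h1, h2⟩
  rw [Omega, mem_ball_zero_iff]
  exact norm_sub_smul_lt_one h.1 hv hr.1 hr.2

/-- A dilation turns `√μ` into `μ`, so the integrability of `√μ(u) (x · u)` follows from the
normalization of the flux measure. -/
theorem sqrt_maxwellian (u : E3) : √(maxwellian u) = maxwellian ((√2)⁻¹ • u) := by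
  have h2 : (√2 : ℝ) ^ 2 = 2 := Real.sq_sqrt (by norm_num)
  rw [maxwellian, ← Real.exp_half, maxwellian, norm_smul, mul_pow, Real.norm_eq_abs, sq_abs,
    inv_pow, h2]
  congr 1
  ring

theorem integrableOn_sqrt_maxwellian_mul_inner {x : E3} (hx : ‖x‖ = 1) :
    IntegrableOn (fun u => √(maxwellian u) * ⟪x, u⟫) {u : E3 | 0 < ⟪x, u⟫} := by
  have h2 : (0 : ℝ) < (√2)⁻¹ := by positivity
  have h1 := ((integrableOn_maxwellian_mul_inner hx).integrable_indicator
    (measurableSet_halfSpace x)).comp_smul h2.ne'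
  rw [← integrable_indicator_iff (measurableSet_halfSpace x)]
  refine (h1.const_mul √2).congr (Eventually.of_forall fun u => ?_)
  simp only [indicator, mem_ofPred_eq, inner_smul_right, mul_pos_iff_of_pos_left h2]
  split_ifs
  · rw [sqrt_maxwellian]
    field_simp
  · simp

theorem IsSolution.integrableOn_flux (hf : IsSolution f₀ f) {t : ℝ} (ht : 0 ≤ t) {x : E3}
    (hx : ‖x‖ = 1) :
    IntegrableOn (fun u => f t x u * √(maxwellian u) * ⟪x, u⟫) {u : E3 | 0 < ⟪x, u⟫} := by
  obtain ⟨K, hK⟩ := hf.bounded t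
  have hmem : ∀ u ∈ {u : E3 | 0 < ⟪x, u⟫}, (x, u) ∈ phaseOffGrazing := fun u hu =>
    ⟨hx.le, fun h => (ne_of_gt hu) h.2⟩
  have hc : ContinuousOn (fun u => f t x u) {u : E3 | 0 < ⟪x, u⟫} :=
    hf.continuousOn.comp (f := fun u : E3 => (t, x, u)) (by fun_prop) fun u hu => ⟨ht, hmem u hu⟩
  refine ((integrableOn_sqrt_maxwellian_mul_inner hx).bdd_mul (c := K)
    (hc.aestronglyMeasurable (measurableSet_halfSpace x)) ?_).congr
    (Eventually.of_forall fun u => (mul_assoc _ _ _).symm)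
  filter_upwards [ae_restrict_mem (measurableSet_halfSpace x)] with u hu
  exact hK t ⟨ht, le_rfl⟩ _ (hmem u hu)

theorem cMu_mul_integral_exp_exitTime (x : E3) :
    cMu * ∫ u in {u : E3 | 0 < ⟪x, u⟫}, Real.exp (-exitTime x u) * (maxwellian u * ⟪x, u⟫) =
      discount x := by
  rw [discount, integral_fluxMeasure]
  simp only [mul_assoc]

theorem integral_sqrt_maxwellian_eq {x y : E3} (h : ‖x‖ = ‖y‖) :
    ∫ u in {u : E3 | 0 < ⟪x, u⟫}, √(maxwellian u) * ⟪x, u⟫ =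
      ∫ u in {u : E3 | 0 < ⟪y, u⟫}, √(maxwellian u) * ⟪y, u⟫ := by
  have key : ∀ x : E3, cMu * ∫ u in {u : E3 | 0 < ⟪x, u⟫}, √(maxwellian u) * ⟪x, u⟫ =
      ∫ u, (√(maxwellian u))⁻¹ ∂fluxMeasure x := fun x => by
    rw [integral_fluxMeasure]
    congr 2
    ext u
    rw [← div_eq_inv_mul, Real.div_sqrt]
  obtain ⟨R, rfl⟩ := exists_isometry_map_eq h
  refine mul_left_cancel₀ cMu_pos.ne' ?_
  rw [key, key, integral_fluxMeasure_map]
  simp only [maxwellian, R.norm_map]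

/-- The difference of the outgoing fluxes of `f` and `g` at the boundary point `x`. -/
def fluxDiff (f g : ℝ → E3 → E3 → ℝ) (t : ℝ) (x : E3) : ℝ :=
  cMu * ∫ u in {u : E3 | 0 < ⟪x, u⟫}, (f t x u - g t x u) * √(maxwellian u) * ⟪x, u⟫

theorem IsSolution.sub_eq_fluxDiff (hf : IsSolution f₀ f) (hg : IsSolution f₀ g) {t : ℝ}
    {x v : E3} (h : (x, v) ∈ phaseOffGrazing) (hv : v ≠ 0) (hτ : exitTime x v ≤ t) :
    f t x v - g t x v =
      √(maxwellian v) * fluxDiff f g (t - exitTime x v) (x - exitTime x v • v) := by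
  obtain ⟨h1, h2, h3⟩ := hf.eq_at_exit h hv hτ
  have ht := sub_nonneg.2 hτ
  rw [h1, (hg.eq_at_exit h hv hτ).1, hf.diffuse _ ht _ _ h2 h3, hg.diffuse _ ht _ _ h2 h3,
    ← mul_sub, ← integral_sub (hf.integrableOn_flux ht h2) (hg.integrableOn_flux ht h2), fluxDiff]
  simp only [sub_mul]
  ring

theorem abs_fluxDiff_le {x : E3} (hx : ‖x‖ = 1) {t S : ℝ}
    (h : ∀ u, 0 < ⟪x, u⟫ → |f t x u - g t x u| ≤ √(maxwellian u) * (Real.exp (-exitTime x u) * S)) :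
    |fluxDiff f g t x| ≤ discount x * S := by
  rw [fluxDiff, abs_mul, abs_of_pos cMu_pos, ← cMu_mul_integral_exp_exitTime, mul_assoc]
  refine mul_le_mul_of_nonneg_left ?_ cMu_pos.le
  rw [← integral_mul_const, ← Real.norm_eq_abs]
  refine norm_integral_le_of_norm_le (Integrable.mul_const ?_ S) ?_
  · refine (integrableOn_maxwellian_mul_inner hx).bdd_mul (c := 1)
      (measurable_exitTime x).neg.exp.aestronglyMeasurable (Eventually.of_forall fun u => ?_)
    rw [Real.norm_eq_abs, Real.abs_exp, Real.exp_le_one_iff]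
    linarith [exitTime_nonneg hx.le u]
  · filter_upwards [ae_restrict_mem (measurableSet_halfSpace x)] with u hu
    rw [norm_mul, norm_mul, Real.norm_eq_abs, Real.norm_eq_abs, Real.norm_eq_abs,
      abs_of_nonneg (Real.sqrt_nonneg _), abs_of_pos hu]
    calc |f t x u - g t x u| * √(maxwellian u) * ⟪x, u⟫
        ≤ √(maxwellian u) * (Real.exp (-exitTime x u) * S) * √(maxwellian u) * ⟪x, u⟫ := by
          have := h u hu
          gcongr
      _ = _ := by
          nth_rewrite 3 [← Real.mul_self_sqrt (maxwellian_pos u).le]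
          ring

theorem IsSolution.abs_fluxDiff_bounded (hf : IsSolution f₀ f) (hg : IsSolution f₀ g) (T : ℝ)
    {e : E3} (he : ‖e‖ = 1) :
    ∃ K, ∀ t ∈ Icc 0 T, ∀ x : E3, ‖x‖ = 1 → |fluxDiff f g t x| ≤ K := by
  obtain ⟨K₁, hK₁⟩ := hf.bounded T
  obtain ⟨K₂, hK₂⟩ := hg.bounded T
  refine ⟨cMu * ((K₁ + K₂) * ∫ u in {u : E3 | 0 < ⟪e, u⟫}, √(maxwellian u) * ⟪e, u⟫),
    fun t ht x hx => ?_⟩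
  rw [fluxDiff, abs_mul, abs_of_pos cMu_pos]
  refine mul_le_mul_of_nonneg_left ?_ cMu_pos.le
  rw [integral_sqrt_maxwellian_eq (he.trans hx.symm), ← integral_const_mul,
    ← Real.norm_eq_abs]
  refine norm_integral_le_of_norm_le ((integrableOn_sqrt_maxwellian_mul_inner hx).const_mul _) ?_
  filter_upwards [ae_restrict_mem (measurableSet_halfSpace x)] with u hu
  have hp : (x, u) ∈ phaseOffGrazing := ⟨hx.le, fun h => hu.ne' h.2⟩
  rw [norm_mul, norm_mul, Real.norm_eq_abs, Real.norm_eq_abs, Real.norm_eq_abs,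
    abs_of_nonneg (Real.sqrt_nonneg _), abs_of_pos hu, mul_assoc]
  refine mul_le_mul_of_nonneg_right ((abs_sub _ _).trans (add_le_add (hK₁ t ht _ hp)
    (hK₂ t ht _ hp))) (mul_nonneg (Real.sqrt_nonneg _) hu.le)

theorem discount_nonneg_lt_one {e : E3} (he : ‖e‖ = 1) : 0 ≤ discount e ∧ discount e < 1 := by
  have := isProbabilityMeasure_fluxMeasure he
  exact ⟨integral_nonneg fun u => (Real.exp_pos _).le,
    (integral_exp_neg_lt_one _ (measurable_exitTime e) (ae_exitTime_pos he)).2⟩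

/-- A bound `S` on `e^{-s} |fluxDiff|` over `[0, t]` and the sphere improves to `discount x * S`: an
outgoing velocity contributes nothing before its exit time, and afterwards contributes the flux
difference delayed by that time. By rotation `discount` is the same at all boundary points. -/
theorem IsSolution.fluxDiff_eq_zero (hf : IsSolution f₀ f) (hg : IsSolution f₀ g) {t : ℝ}
    (ht : 0 ≤ t) {x : E3} (hx : ‖x‖ = 1) : fluxDiff f g t x = 0 := by
  obtain ⟨K, hK⟩ := hf.abs_fluxDiff_bounded hg t hx
  obtain ⟨hq0, hq⟩ := discount_nonneg_lt_one hx
  have key := nonpos_of_bound_improves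
    (φ := fun i : Icc 0 t × Metric.sphere (0 : E3) 1 =>
      Real.exp (-i.1) * |fluxDiff f g i.1 i.2|) (K := K) hq0 hq ?_ ?_
      ⟨⟨t, ht, le_rfl⟩, ⟨x, by simpa using hx⟩⟩
  · simp only at key
    have h1 := nonpos_of_mul_nonpos_right key (Real.exp_pos _)
    exact abs_eq_zero.1 (le_antisymm h1 (abs_nonneg _))
  · rintro ⟨⟨s, hs⟩, ⟨y, hy⟩⟩
    refine (mul_le_of_le_one_left (abs_nonneg _) ?_).trans (hK s hs y (by simpa using hy))
    rw [Real.exp_le_one_iff]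
    simpa using hs.1
  · rintro S hS ⟨⟨s, hs⟩, ⟨y, hy⟩⟩
    have hy' : ‖y‖ = 1 := by simpa using hy
    simp only
    have hS0 : 0 ≤ S := (mul_nonneg (Real.exp_pos _).le (abs_nonneg _)).trans (hS ⟨⟨s, hs⟩, ⟨y, hy⟩⟩)
    have h1 : |fluxDiff f g s y| ≤ discount y * (Real.exp s * S) := by
      refine abs_fluxDiff_le hy' fun u hu => ?_
      have hu0 := ne_zero_of_inner_ne_zero hu.ne'
      have hp : (y, u) ∈ phaseOffGrazing := ⟨hy'.le, fun h => hu.ne' h.2⟩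
      rcases lt_or_ge s (exitTime y u) with hlt | hle
      · rw [hf.eq_before_exit hg hs.1 hp hu0 hlt, sub_self, abs_zero]
        positivity
      · rw [hf.sub_eq_fluxDiff hg hp hu0 hle, abs_mul, abs_of_nonneg (Real.sqrt_nonneg _)]
        refine mul_le_mul_of_nonneg_left ?_ (Real.sqrt_nonneg _)
        have h2 := hS ⟨⟨s - exitTime y u, sub_nonneg.2 hle,
          by linarith [exitTime_nonneg hy'.le u, hs.2]⟩,
          ⟨y - exitTime y u • u, by simpa using norm_sub_exitTime_smul hy'.le hu0⟩⟩
        simp only at h2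
        rw [Real.exp_neg, inv_mul_le_iff₀ (Real.exp_pos _), Real.exp_sub, div_eq_mul_inv,
          ← Real.exp_neg] at h2
        linarith
    rw [Real.exp_neg, inv_mul_le_iff₀ (Real.exp_pos _), discount_eq (hx.trans hy'.symm)]
    linarith

theorem IsSolution.unique (hf : IsSolution f₀ f) (hg : IsSolution f₀ g) {t : ℝ} (ht : 0 ≤ t)
    {x v : E3} (h : (x, v) ∈ phaseOffGrazing) : f t x v = g t x v := by
  have hpos : ∀ s, 0 < s → f s x v = g s x v := fun s hs => by
    by_cases hv : v = 0
    · subst hv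
      have hx : x ∈ Omega := by
        rw [Omega, mem_ball_zero_iff]
        exact lt_of_le_of_ne h.1 fun h' => h.2 ⟨h', by simp⟩
      have h1 : (x - s • (0 : E3), (0 : E3)) ∈ phaseOffGrazing := by simpa using h
      rw [hf.eq_along_characteristic hs.le le_rfl h h1 fun r _ => by simpa using hx,
        hg.eq_along_characteristic hs.le le_rfl h h1 fun r _ => by simpa using hx]
      simp [hf.initial x hx, hg.initial x hx]
    rcases lt_or_ge s (exitTime x v) with hlt | hle
    · exact hf.eq_before_exit hg hs.le h hv hlt
    · rw [← sub_eq_zero, hf.sub_eq_fluxDiff hg h hv hle, hf.fluxDiff_eq_zero hg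
        (sub_nonneg.2 hle) (norm_sub_exitTime_smul h.1 hv), mul_zero]
  rcases ht.eq_or_lt with rfl | ht
  · refine eq_at_zero_of_eventually_eq (hf.continuousOn_time h) (hg.continuousOn_time h) ?_
    filter_upwards [self_mem_nhdsWithin] with s hs
    exact hpos s hs
  · exact hpos t ht

end Uniqueness

/-! ### Divergence at the grazing set. -/

theorem lintegral_neg_inv_gaussian_eq_top :
    ∫⁻ y : ℝ, indicator (Iio 0) (fun y => ENNReal.ofReal (Real.exp (-y ^ 2 / 2) * |y|⁻¹)) y = ⊤ := by
  by_contra h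
  rw [lintegral_indicator measurableSet_Iio] at h
  have h1 : IntegrableOn (fun y : ℝ => Real.exp (-y ^ 2 / 2) * |y|⁻¹) (Ioo (-1) 0) := by
    refine ⟨(by fun_prop : Measurable _).aestronglyMeasurable, ?_⟩
    rw [hasFiniteIntegral_iff_ofReal (Eventually.of_forall fun y => by
      simp only [Pi.zero_apply]; positivity)]
    exact (lintegral_mono_set Ioo_subset_Iio_self).trans_lt (lt_top_iff_ne_top.2 h)
  have h2 : IntegrableOn (fun y : ℝ => y⁻¹) (Ioo (-1) 0) := by
    refine (h1.const_mul (Real.exp (1 / 2))).mono' measurable_inv.aestronglyMeasurable ?_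
    filter_upwards [ae_restrict_mem measurableSet_Ioo] with y hy
    rw [norm_inv, Real.norm_eq_abs, ← mul_assoc, ← Real.exp_add]
    refine le_mul_of_one_le_left (by positivity) (Real.one_le_exp ?_)
    nlinarith [hy.1, hy.2]
  have h3 : IntervalIntegrable (fun y : ℝ => y⁻¹) volume (-1) 0 := by
    rw [intervalIntegrable_iff_integrableOn_Ioo_of_le (by norm_num)]
    exact h2
  rw [intervalIntegrable_inv_iff] at h3
  rcases h3 with h3 | h3
  · norm_num at h3
  · exact h3 right_mem_uIcc

theorem lintegral_maxwellian_mul_inv_inner {x : E3} (hx : ‖x‖ = 1) :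
    ∫⁻ v in {v : E3 | ⟪x, v⟫ < 0}, ENNReal.ofReal (maxwellian v * |⟪x, v⟫|⁻¹) = ⊤ := by
  have hms : ∀ x : E3, MeasurableSet {u : E3 | ⟪x, u⟫ < 0} := fun x =>
    measurableSet_lt (by fun_prop) measurable_const
  obtain ⟨R, rfl⟩ := exists_isometry_map_eq
    (x := (EuclideanSpace.single 0 1 : E3)) (y := x) (by simp [hx])
  set φ : ℝ → ℝ≥0∞ := indicator (Iio 0)
    (fun y => ENNReal.ofReal (Real.exp (-y ^ 2 / 2) * |y|⁻¹))
  set ψ : (Fin 2 → ℝ) → ℝ≥0∞ := fun z => ENNReal.ofReal (Real.exp (-(z 0 ^ 2 + z 1 ^ 2) / 2))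
  have hφ : Measurable φ :=
    ((by fun_prop : Measurable fun y : ℝ => Real.exp (-y ^ 2 / 2) * |y|⁻¹).ennreal_ofReal).indicator
      measurableSet_Iio
  have hψ : Measurable ψ := by fun_prop
  rw [← lintegral_indicator (hms _),
    ← R.measurePreserving.lintegral_comp_emb R.toHomeomorph.measurableEmbedding,
    ← (PiLp.volume_preserving_toLp (Fin 3)).lintegral_comp_emb
      (MeasurableEquiv.toLp 2 (Fin 3 → ℝ)).measurableEmbedding]
  have h1 : ∀ y : Fin 3 → ℝ, indicator {u : E3 | ⟪R (EuclideanSpace.single 0 1), u⟫ < 0}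
      (fun v => ENNReal.ofReal (maxwellian v * |⟪R (EuclideanSpace.single 0 1), v⟫|⁻¹))
      (R (WithLp.toLp 2 y)) =
      (fun p : ℝ × (Fin 2 → ℝ) => φ p.1 * ψ p.2)
        (MeasurableEquiv.piFinSuccAbove (fun _ : Fin 3 => ℝ) 0 y) := fun y => by
    have hy : -‖(WithLp.toLp 2 y : E3)‖ ^ 2 / 2
        = -y 0 ^ 2 / 2 + -(y 1 ^ 2 + y 2 ^ 2) / 2 := by
      rw [EuclideanSpace.norm_sq_eq, Fin.sum_univ_three]
      simp only [Real.norm_eq_abs, sq_abs]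
      ring
    have hy0 : ⟪(EuclideanSpace.single 0 1 : E3), WithLp.toLp 2 y⟫ = y 0 := by
      simp [EuclideanSpace.inner_single_left]
    have hp : MeasurableEquiv.piFinSuccAbove (fun _ : Fin 3 => ℝ) 0 y =
      (y 0, fun j => y (Fin.succAbove 0 j)) := rfl
    simp only [hp, φ, ψ, indicator, mem_ofPred_eq, mem_Iio, R.inner_map_map, hy0, maxwellian,
      R.norm_map, hy, Real.exp_add]
    split_ifs
    · rw [← ENNReal.ofReal_mul (by positivity)]
      congr 1
      change _ = Real.exp (-y 0 ^ 2 / 2) * |y 0|⁻¹ * Real.exp (-(y 1 ^ 2 + y 2 ^ 2) / 2)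
      ring
    · rw [zero_mul]
  simp only [h1]
  have h2 : Measurable fun p : ℝ × (Fin 2 → ℝ) => φ p.1 * ψ p.2 := by fun_prop
  refine ((volume_preserving_piFinSuccAbove (fun _ : Fin 3 => ℝ) 0).lintegral_comp h2).trans ?_
  rw [Measure.volume_eq_prod, lintegral_prod_mul hφ.aemeasurable hψ.aemeasurable, lintegral_neg_inv_gaussian_eq_top,
    ENNReal.top_mul]
  rw [Ne, lintegral_eq_zero_iff hψ]
  intro h
  obtain ⟨z, hz⟩ := h.exists
  simp only [ψ, Pi.zero_apply, ENNReal.ofReal_eq_zero] at hz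
  exact absurd (Real.exp_pos _) hz.not_gt

theorem measurableSet_gammaMinus : MeasurableSet gammaMinus :=
  measurableSet_lt (by fun_prop) measurable_const

/-- One power of `|n · v|` from `dγ` cancels against the square of `|n · v|⁻¹`, leaving the
non-integrable `μ(v) / |n · v|` for every boundary point. Passing to the explicit minorant avoids
measurability of `h`. -/
theorem boundary_lintegral_eq_top {h : E3 → E3 → E3} {c : ℝ} (hc : 0 < c)
    (hh : ∀ x v, ‖x‖ = 1 → ⟪x, v⟫ < 0 → c * (√(maxwellian v) * |⟪x, v⟫|⁻¹) ≤ ‖h x v‖) :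
    ∫⁻ p in gammaMinus, ‖h p.1 p.2‖ₑ ^ 2 ∂gammaMeasure = ⊤ := by
  have hmM : Measurable maxwellian := (contDiff_maxwellian (n := 0)).continuous.measurable
  have hm : Measurable fun p : Metric.sphere (0 : E3) 1 × E3 =>
      ENNReal.ofReal (c ^ 2) * ENNReal.ofReal (maxwellian p.2 * |⟪(p.1 : E3), p.2⟫|⁻¹) := by
    fun_prop
  have hm' : Measurable fun p : Metric.sphere (0 : E3) 1 × E3 =>
      ENNReal.ofReal ((c * (√(maxwellian p.2) * |⟪(p.1 : E3), p.2⟫|⁻¹)) ^ 2) := by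
    fun_prop
  have h1 : ∫⁻ p in gammaMinus, ENNReal.ofReal
      ((c * (√(maxwellian p.2) * |⟪(p.1 : E3), p.2⟫|⁻¹)) ^ 2) ∂gammaMeasure ≤
      ∫⁻ p in gammaMinus, ‖h p.1 p.2‖ₑ ^ 2 ∂gammaMeasure := by
    refine setLIntegral_mono' measurableSet_gammaMinus fun p hp => ?_
    rw [ENNReal.ofReal_pow (by have := Real.sqrt_nonneg (maxwellian p.2); positivity),
      ← ofReal_norm]
    exact pow_le_pow_left' (ENNReal.ofReal_le_ofReal (hh _ _ (by simp) hp)) 2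
  refine top_le_iff.1 (le_trans (le_of_eq ?_) h1)
  rw [gammaMeasure, setLIntegral_withDensity_eq_setLIntegral_mul _ (by fun_prop) hm'
    measurableSet_gammaMinus]
  have h2 : ∀ p ∈ gammaMinus, ((fun p : Metric.sphere (0 : E3) 1 × E3 =>
      ENNReal.ofReal |⟪(p.1 : E3), p.2⟫|) * fun p : Metric.sphere (0 : E3) 1 × E3 =>
        ENNReal.ofReal ((c * (√(maxwellian p.2) * |⟪(p.1 : E3), p.2⟫|⁻¹)) ^ 2)) p =
      ENNReal.ofReal (c ^ 2) * ENNReal.ofReal (maxwellian p.2 * |⟪(p.1 : E3), p.2⟫|⁻¹) :=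
    fun p hp => by
    have h0 : |⟪(p.1 : E3), p.2⟫| ≠ 0 := abs_ne_zero.2 (ne_of_lt hp)
    rw [Pi.mul_apply, ← ENNReal.ofReal_mul (abs_nonneg _), ← ENNReal.ofReal_mul (sq_nonneg _)]
    congr 1
    rw [mul_pow, mul_pow, Real.sq_sqrt (maxwellian_pos _).le]
    field_simp
  rw [setLIntegral_congr_fun measurableSet_gammaMinus h2,
    ← lintegral_indicator measurableSet_gammaMinus,
    lintegral_prod _ (hm.indicator measurableSet_gammaMinus).aemeasurable]
  have h3 : ∀ x : Metric.sphere (0 : E3) 1, ∫⁻ v, indicator gammaMinus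
      (fun p => ENNReal.ofReal (c ^ 2) *
        ENNReal.ofReal (maxwellian p.2 * |⟪(p.1 : E3), p.2⟫|⁻¹)) (x, v) = ⊤ := fun x => by
    have hx : ‖(x : E3)‖ = 1 := by simp
    have h4 : ∀ v, indicator gammaMinus (fun p => ENNReal.ofReal (c ^ 2) *
        ENNReal.ofReal (maxwellian p.2 * |⟪(p.1 : E3), p.2⟫|⁻¹)) (x, v) =
        indicator {v : E3 | ⟪(x : E3), v⟫ < 0} (fun v => ENNReal.ofReal (c ^ 2) *
        ENNReal.ofReal (maxwellian v * |⟪(x : E3), v⟫|⁻¹)) v := fun v => rfl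
    simp only [h4]
    rw [lintegral_indicator (measurableSet_lt (by fun_prop) measurable_const),
      lintegral_const_mul _ (by fun_prop), lintegral_maxwellian_mul_inv_inner hx,
      ENNReal.mul_top (by simpa using hc.ne')]
  simp only [h3, lintegral_const]
  rw [ENNReal.top_mul]
  rw [Ne, Measure.measure_univ_eq_zero]
  exact Measure.toSphere_ne_zero volume

/-- At `s = 0` the root equals `|x · v| = -(x · v)`, so the terms without `‖v‖²` cancel. The formula
extends past the sphere, which makes the two-sided derivative meaningful. -/
theorem hasDerivAt_exitTime_radial {x v : E3} (hx : ‖x‖ = 1) (hv : ⟪x, v⟫ < 0) :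
    HasDerivAt (fun s : ℝ => exitTime (x + s • x) v) (⟪x, v⟫)⁻¹ 0 := by
  have hv0 : ‖v‖ ≠ 0 := norm_ne_zero_iff.2 (ne_zero_of_inner_ne_zero hv.ne)
  set c := ⟪x, v⟫
  have h1 : (fun s : ℝ => exitTime (x + s • x) v) = fun s =>
      ((1 + s) * c + √(((1 + s) * c) ^ 2 + ‖v‖ ^ 2 * (1 - (1 + s) ^ 2))) / ‖v‖ ^ 2 := by
    ext s
    have h2 : x + s • x = (1 + s) • x := by rw [add_smul, one_smul]
    rw [exitTime, exitDisc, h2, real_inner_smul_left, norm_smul, hx, mul_one, Real.norm_eq_abs,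
      sq_abs]
  have hs : HasDerivAt (fun s : ℝ => 1 + s) 1 0 := (hasDerivAt_id 0).const_add 1
  have h3 : HasDerivAt (fun s : ℝ => ((1 + s) * c) ^ 2 + ‖v‖ ^ 2 * (1 - (1 + s) ^ 2))
      (2 * c ^ 2 - 2 * ‖v‖ ^ 2) 0 := by
    refine (((hs.mul_const c).pow 2).add (((hs.pow 2).const_sub 1).const_mul _)).congr_deriv ?_
    simp
    ring
  have h4 := h3.sqrt (by simpa using hv.ne)
  rw [h1]
  refine (((hs.mul_const c).add h4).div_const _).congr_deriv ?_
  simp only [add_zero, one_mul, one_pow, sub_self, mul_zero, Real.sqrt_sq_eq_abs, abs_of_neg hv]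
  have := hv.ne
  field_simp
  ring

theorem le_norm_gradX_transportSol {G : E3 → E3 → ℝ} (hG : IsDatum G) {m : ℝ → ℝ}
    (hm : ContDiff ℝ 1 m) (hm0 : ∀ t ≤ 0, m t = 0) {t : ℝ} (ht : 0 < t) {x v : E3}
    (hx : ‖x‖ = 1) (hv : ⟪x, v⟫ < 0) :
    |deriv m t| * (√(maxwellian v) * |⟪x, v⟫|⁻¹) ≤ ‖gradX (transportSol G m) t x v‖ := by
  have hv0 := ne_zero_of_inner_ne_zero hv.ne
  have hd := (contDiffAt_transportSol hG hm hm0 t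
    ⟨hx.le, fun h => hv.ne h.2⟩).differentiableAt (by simp)
  have h1 : HasDerivAt (fun s : ℝ => transportSol G m t (x + s • x) v)
      ⟪x, gradX (transportSol G m) t x v⟫ 0 := by
    rw [real_inner_comm, gradX, gradient, InnerProductSpace.toDual_symm_apply]
    have h2 := (hasFDerivAt_slice_x hd).differentiableAt.hasFDerivAt
    refine HasFDerivAt.comp_hasDerivAt_of_eq (l := fun y => transportSol G m t y v)
      (f := fun s : ℝ => x + s • x) 0 h2 ?_ (by simp)
    simpa using ((hasDerivAt_id (0 : ℝ)).smul_const x).const_add x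
  have h3 : HasDerivAt (fun s : ℝ => √(maxwellian v) * m (t - exitTime (x + s • x) v))
      (√(maxwellian v) * (deriv m t * -(⟪x, v⟫)⁻¹)) 0 := by
    refine HasDerivAt.const_mul _ ?_
    refine HasDerivAt.comp_of_eq (h₂ := m) (h := fun s : ℝ => t - exitTime (x + s • x) v) 0
      (hm.differentiable (by simp) t).hasDerivAt
      ((hasDerivAt_exitTime_radial hx hv).const_sub t) ?_
    simp [exitTime_incoming hx hv]
  have h4 : (fun s : ℝ => transportSol G m t (x + s • x) v) =ᶠ[𝓝 0]
      fun s => √(maxwellian v) * m (t - exitTime (x + s • x) v) := by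
    have hc : ContinuousAt (fun s : ℝ => ‖x + s • x - t • v‖) 0 := by fun_prop
    -- An incoming characteristic traced backwards for time `t > 0` lies strictly outside the closed
    -- ball, so near `x` only the `m` term is present.
    have h5 : 1 < ‖x - t • v‖ := by
      have h6 := norm_sub_sq_real x (t • v)
      rw [inner_smul_right, hx] at h6
      nlinarith [norm_nonneg (x - t • v), sq_nonneg ‖t • v‖, mul_neg_of_pos_of_neg ht hv]
    filter_upwards [hc.eventually_const_lt (u := 1) (by simpa using h5)] with s hs
    rw [transportSol, if_neg hv0, image_eq_zero_of_notMem_tsupport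
      (f := fun p : E3 × E3 => G p.1 p.2) (x := (x + s • x - t • v, v))
      (hG.notMem_tsupport (Or.inl hs.le)), zero_add]
  have h7 := h1.unique (h3.congr_of_eventuallyEq h4)
  have h8 := abs_real_inner_le_norm x (gradX (transportSol G m) t x v)
  rw [h7, hx, one_mul, abs_mul, abs_mul, abs_neg, abs_inv,
    abs_of_nonneg (Real.sqrt_nonneg _)] at h8
  linarith

/-! ### The bump data and their norms. -/

/-- A smooth radial bump in position times a smooth radial bump in velocity. -/
def bumpDatum (A r : ℝ) (x v : E3) : ℝ :=
  -- The bound `3 / 4` is below `1`, for the support condition, and above `1 / 4`, so that the speed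
  -- `1 / 2` used in `source_pos` is charged.
  A * (expNegInvGlue (r - ‖x‖ ^ 2) * expNegInvGlue (3 / 4 - ‖v‖ ^ 2))

theorem contDiff_bumpDatum (A r : ℝ) : ContDiff ℝ ∞ fun p : E3 × E3 => bumpDatum A r p.1 p.2 :=
  contDiff_const.mul ((expNegInvGlue.contDiff.comp (contDiff_const.sub (contDiff_fst.norm_sq ℝ))).mul
    (expNegInvGlue.contDiff.comp (contDiff_const.sub (contDiff_snd.norm_sq ℝ))))

theorem tsupport_bumpDatum (A r : ℝ) : tsupport (fun p : E3 × E3 => bumpDatum A r p.1 p.2) ⊆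
    {p : E3 × E3 | ‖p.1‖ ^ 2 ≤ r ∧ ‖p.2‖ ^ 2 ≤ 3 / 4} := by
  have h1 : IsClosed {p : E3 × E3 | ‖p.1‖ ^ 2 ≤ r} := isClosed_le (by fun_prop) continuous_const
  have h2 : IsClosed {p : E3 × E3 | ‖p.2‖ ^ 2 ≤ 3 / 4} :=
    isClosed_le (by fun_prop) continuous_const
  refine closure_minimal (fun p hp => ?_) (h1.inter h2)
  by_contra h
  refine hp ?_
  rw [mem_ofPred_eq, not_and_or, not_le, not_le] at h
  rcases h with h | h
  · simp only [bumpDatum]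
    rw [expNegInvGlue.zero_of_nonpos (by linarith : r - ‖p.1‖ ^ 2 ≤ 0), zero_mul, mul_zero]
  · simp only [bumpDatum]
    rw [expNegInvGlue.zero_of_nonpos (by linarith : 3 / 4 - ‖p.2‖ ^ 2 ≤ 0), mul_zero, mul_zero]

theorem isDatum_bumpDatum {A r : ℝ} (hA : 0 ≤ A) (hr : r < 1) : IsDatum (bumpDatum A r) where
  smooth := contDiff_bumpDatum A r
  compact := by
    refine ((isCompact_closedBall (0 : E3) 1).prod (isCompact_closedBall (0 : E3) 1)).of_isClosed_subset
      (isClosed_tsupport _) ((tsupport_bumpDatum A r).trans fun p hp => ?_)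
    simp only [mem_ofPred_eq] at hp
    simp only [mem_prod, mem_closedBall_zero_iff]
    constructor <;> nlinarith [hp.1, hp.2, norm_nonneg p.1, norm_nonneg p.2]
  support := (tsupport_bumpDatum A r).trans fun p hp => by
    simp only [mem_ofPred_eq] at hp
    simp only [mem_prod, mem_ball_zero_iff]
    constructor <;> nlinarith [hp.1, hp.2, norm_nonneg p.1, norm_nonneg p.2]
  nonneg := fun x v => mul_nonneg hA (mul_nonneg (expNegInvGlue.nonneg _) (expNegInvGlue.nonneg _))

theorem bumpDatum_map (A r : ℝ) (R : E3 ≃ₗᵢ[ℝ] E3) (x v : E3) :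
    bumpDatum A r (R x) (R v) = bumpDatum A r x v := by
  simp only [bumpDatum, R.norm_map]

theorem bumpDatum_pos {A r : ℝ} (hA : 0 < A) {x v : E3} (hx : ‖x‖ ^ 2 < r)
    (hv : ‖v‖ ^ 2 < 3 / 4) : 0 < bumpDatum A r x v :=
  mul_pos hA (mul_pos (expNegInvGlue.pos_of_pos (sub_pos.2 hx))
    (expNegInvGlue.pos_of_pos (sub_pos.2 hv)))

theorem IsDatum.sqrt_maxwellian_mul {G : E3 → E3 → ℝ} (hG : IsDatum G) :
    IsDatum fun x v => √(maxwellian v) * G x v where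
  smooth := (contDiff_sqrt_maxwellian.comp contDiff_snd).mul hG.smooth
  compact := hG.compact.mul_left (f := fun p : E3 × E3 => √(maxwellian p.2))
  support := (tsupport_mul_subset_right (f := fun p : E3 × E3 => √(maxwellian p.2))).trans
    hG.support
  nonneg := fun x v => mul_nonneg (Real.sqrt_nonneg _) (hG.nonneg x v)

theorem weightedSupNorm_const_mul (θ c : ℝ) (f : E3 → E3 → ℝ) :
    weightedSupNorm θ (fun x v => c * f x v) = |c| * weightedSupNorm θ f := by
  unfold weightedSupNorm
  have : (fun z : E3 × E3 => Real.exp (θ * ‖z.2‖ ^ 2) * (c * f z.1 z.2)) =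
      c • fun z : E3 × E3 => Real.exp (θ * ‖z.2‖ ^ 2) * f z.1 z.2 := by
    ext z
    simp only [Pi.smul_apply, smul_eq_mul]
    ring
  rw [this, eLpNorm_const_smul, ENNReal.toReal_mul, toReal_enorm, Real.norm_eq_abs]

theorem IsDatum.weightedSupNorm_pos (θ : ℝ) {f₀ : E3 → E3 → ℝ} (hf : IsDatum f₀) {x v : E3}
    (hx : x ∈ Omega) (h : f₀ x v ≠ 0) : 0 < weightedSupNorm θ f₀ := by
  set H : E3 × E3 → ℝ := fun z => Real.exp (θ * ‖z.2‖ ^ 2) * f₀ z.1 z.2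
  have hc : Continuous H := by
    have := hf.smooth.continuous
    fun_prop
  have hcs : HasCompactSupport H :=
    hf.compact.mul_left (f := fun z : E3 × E3 => Real.exp (θ * ‖z.2‖ ^ 2))
  -- Finiteness matters: `toReal` would send an infinite norm to `0`.
  have hfin : eLpNorm H ∞ (volume.restrict (Omega ×ˢ (univ : Set E3))) ≠ ⊤ :=
    ((hc.memLp_of_hasCompactSupport hcs (p := ∞) (μ := volume)).restrict _).eLpNorm_ne_top
  have hO : IsOpen (Omega ×ˢ (univ : Set E3)) := Metric.isOpen_ball.prod isOpen_univ
  refine ENNReal.toReal_pos (fun h0 => ?_) hfin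
  rw [eLpNorm_eq_zero_iff hc.aestronglyMeasurable (by simp)] at h0
  have h1 := Measure.eqOn_open_of_ae_eq h0 hO hc.continuousOn continuousOn_const
    (⟨hx, mem_univ v⟩ : (x, v) ∈ Omega ×ˢ (univ : Set E3))
  exact mul_ne_zero (Real.exp_pos _).ne' h h1

theorem IsDatum.bulkNormPow_two_lt_top {f₀ : E3 → E3 → ℝ} (hf : IsDatum f₀) :
    bulkNormPow 2 (fun x v => gradient (fun y => f₀ y v) x) < ⊤ ∧
      bulkNormPow 2 (fun x v => gradient (fun w => f₀ x w) v) < ⊤ := by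
  set H : E3 × E3 → ℝ := fun p => f₀ p.1 p.2
  have hd : Differentiable ℝ H := hf.smooth.differentiable (by simp)
  have hfin : ∫⁻ z, ‖fderiv ℝ H z‖ₑ ^ (2 : ℝ) < ⊤ := by
    have h1 := ((hf.smooth.continuous_fderiv (by simp)).memLp_of_hasCompactSupport
      (hf.compact.fderiv ℝ) (p := 2) (μ := volume)).2
    simpa using lintegral_rpow_enorm_lt_top_of_eLpNorm_lt_top (by simp) (by simp) h1
  have key : ∀ h : E3 → E3 → E3, (∀ x v, ‖h x v‖ ≤ ‖fderiv ℝ H (x, v)‖) →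
      bulkNormPow 2 h < ⊤ := fun h hh => by
    refine lt_of_le_of_lt ?_ hfin
    refine (setLIntegral_le_lintegral _ _).trans (lintegral_mono fun z => ?_)
    exact ENNReal.rpow_le_rpow (enorm_le_iff_norm_le.2 (hh z.1 z.2)) (by norm_num)
  constructor
  · refine key _ fun x v => ?_
    have h1 : HasFDerivAt (fun y => f₀ y v) _ x :=
      HasFDerivAt.comp (g := H) (f := fun y : E3 => (y, v)) x (hd (x, v)).hasFDerivAt
        (hasFDerivAt_prodMk_left x v)
    rw [gradient, LinearIsometryEquiv.norm_map, h1.fderiv]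
    exact (ContinuousLinearMap.opNorm_comp_le _ _).trans (mul_le_of_le_one_right (norm_nonneg _)
      (ContinuousLinearMap.norm_inl_le_one _ _ _))
  · refine key _ fun x v => ?_
    have h1 : HasFDerivAt (fun w => f₀ x w) _ v :=
      HasFDerivAt.comp (g := H) (f := fun w : E3 => (x, w)) v (hd (x, v)).hasFDerivAt
        (hasFDerivAt_prodMk_right x v)
    rw [gradient, LinearIsometryEquiv.norm_map, h1.fderiv]
    exact (ContinuousLinearMap.opNorm_comp_le _ _).trans (mul_le_of_le_one_right (norm_nonneg _)
      (ContinuousLinearMap.norm_inr_le_one _ _ _))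

/-- The velocity `e / 2` traced back from `e` for time `t` lands at `(1 - t / 2) e`, inside the
bump; by continuity an open set of outgoing velocities contributes. -/
theorem source_pos {A t r : ℝ} (hA : 0 < A) (hr : (1 - t / 2) ^ 2 < r) (hr1 : r < 1) {e : E3} (he : ‖e‖ = 1) :
    0 < ∫ u, bumpDatum A r (e - t • u) u ∂fluxMeasure e := by
  have hG := isDatum_bumpDatum hA.le hr1
  have hc : Continuous fun u : E3 => bumpDatum A r (e - t • u) u :=
    hG.smooth.continuous.comp (f := fun u : E3 => (e - t • u, u)) (by fun_prop)
  obtain ⟨C, hC⟩ := hG.smooth.continuous.bounded_above_of_compact_support hG.compact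
  have hmem : (2⁻¹ : ℝ) • e ∈ {u : E3 | 0 < bumpDatum A r (e - t • u) u} ∩ {u | 0 < ⟪e, u⟫} := by
    refine ⟨bumpDatum_pos hA ?_ ?_, ?_⟩
    · have h1 : e - t • (2⁻¹ : ℝ) • e = (1 - t / 2) • e := by
        rw [smul_smul, sub_smul, one_smul, div_eq_mul_inv]
      rw [h1, norm_smul, he, mul_one, Real.norm_eq_abs, sq_abs]
      exact hr
    · rw [norm_smul, he]
      norm_num
    · simp only [mem_ofPred_eq, inner_smul_right, real_inner_self_eq_norm_sq, he]
      norm_num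
  have hopen : IsOpen ({u : E3 | 0 < bumpDatum A r (e - t • u) u} ∩ {u | 0 < ⟪e, u⟫}) :=
    (isOpen_lt continuous_const hc).inter (isOpen_lt continuous_const (by fun_prop))
  rw [integral_fluxMeasure]
  refine mul_pos cMu_pos ((setIntegral_pos_iff_support_of_nonneg_ae ?_ ?_).2
    ((hopen.measure_pos volume ⟨_, hmem⟩).trans_le (measure_mono fun u hu => ⟨?_, hu.2⟩)))
  · filter_upwards [ae_restrict_mem (measurableSet_halfSpace e)] with u hu
    exact mul_nonneg (mul_nonneg (hG.nonneg _ _) (maxwellian_pos u).le) (le_of_lt hu)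
  · exact ((integrableOn_maxwellian_mul_inner he).bdd_mul (c := C) hc.aestronglyMeasurable
      (Eventually.of_forall fun u => hC (e - t • u, u))).congr
      (Eventually.of_forall fun u => (mul_assoc _ _ _).symm)
  · exact (mul_pos (mul_pos hu.1 (maxwellian_pos u)) hu.2).ne'

theorem exists_deriv_ne_zero {m : ℝ → ℝ} (hm : ContDiff ℝ 1 m) {t : ℝ}
    (hm0 : ∀ s ≤ 0, m s = 0) (h : ∃ s ≤ t, m s ≠ 0) : ∃ s ∈ Ioo 0 t, deriv m s ≠ 0 := by
  by_contra! hd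
  obtain ⟨s, hst, hs⟩ := h
  rcases le_or_gt s 0 with h0 | h0
  · exact hs (hm0 s h0)
  obtain ⟨c, hc, hcs⟩ := exists_deriv_eq_slope m h0 hm.continuous.continuousOn
    (hm.differentiable (by simp)).differentiableOn
  rw [hd c ⟨hc.1, hc.2.trans_le hst⟩, eq_comm, div_eq_zero_iff, hm0 0 le_rfl] at hcs
  rcases hcs with hcs | hcs
  · exact hs (by linarith)
  · linarith

/-! ### Blow-up of the boundary integral and failure of the estimate. -/

theorem exists_datum_boundary_blowup (θ : ℝ) {T : ℝ} (hT : 0 < T) :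
    ∃ f₀, IsDatum f₀ ∧ weightedSupNorm θ f₀ = 1 ∧ ∃ f, IsSolution f₀ f ∧
      IsTrace (gradX f) (gradX f) ∧ IsTrace (gradV f) (gradV f) ∧
      ∫⁻ s in Icc 0 T, ∫⁻ p in gammaMinus, ‖gradX f s p.1 p.2‖ₑ ^ 2 ∂gammaMeasure = ⊤ := by
  obtain ⟨t, ht0, htT, ht1⟩ : ∃ t, 0 < t ∧ t < T ∧ t < 1 := by
    obtain ⟨t, h1, h2⟩ := exists_between (lt_min hT one_pos)
    exact ⟨t, h1, h2.trans_le (min_le_left _ _), h2.trans_le (min_le_right _ _)⟩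
  obtain ⟨r, hr, hr1⟩ : ∃ r, (1 - t / 2) ^ 2 < r ∧ r < 1 := exists_between (by nlinarith)
  have hr0 : 0 < r := (sq_nonneg _).trans_lt hr
  obtain ⟨A, hA, hnorm⟩ : ∃ A, 0 < A ∧
      weightedSupNorm θ (fun x v => √(maxwellian v) * bumpDatum A r x v) = 1 := by
    have hW := (isDatum_bumpDatum zero_le_one hr1).sqrt_maxwellian_mul.weightedSupNorm_pos θ
      (x := 0) (v := 0) (by simp [Omega]) (mul_pos (Real.sqrt_pos.2 (maxwellian_pos _))
        (bumpDatum_pos one_pos (by simpa using hr0) (by norm_num))).ne'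
    refine ⟨_, inv_pos.2 hW, ?_⟩
    have key : ∀ A, weightedSupNorm θ (fun x v => √(maxwellian v) * bumpDatum A r x v) =
        |A| * weightedSupNorm θ (fun x v => √(maxwellian v) * bumpDatum 1 r x v) := fun A => by
      rw [← weightedSupNorm_const_mul]
      congr 1
      ext x v
      simp only [bumpDatum]
      ring
    rw [key, abs_of_pos (inv_pos.2 hW), inv_mul_cancel₀ hW.ne']
  have hG := isDatum_bumpDatum hA.le hr1
  obtain ⟨e, he⟩ : ∃ e : E3, ‖e‖ = 1 := ⟨EuclideanSpace.single 0 1, by simp⟩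
  have := isProbabilityMeasure_fluxMeasure he
  obtain ⟨b, B, hab, hb, hB, ha0, hb0⟩ := hG.hasDerivAt_source he
  obtain ⟨m, hm, hm0, hmr⟩ := exists_renewal (fluxMeasure e) (measurable_exitTime e)
    (ae_exitTime_pos he) hab hb hB ha0 hb0
  have htr := isTrace_transportSol hG hm hm0
  refine ⟨_, hG.sqrt_maxwellian_mul, hnorm, transportSol (bumpDatum A r) m,
    isSolution_transportSol hG (bumpDatum_map A r) hm hm0 he hmr, htr.1, htr.2, ?_⟩
  -- If `m` vanished up to time `t`, the delayed term would vanish too, since the delays are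
  -- positive, and the renewal equation would make the source at `t` zero.
  obtain ⟨s, hs, hds⟩ := exists_deriv_ne_zero hm hm0 (by
    by_contra! h
    have h1 := hmr t
    rw [h t le_rfl, integral_eq_zero_of_ae (f := fun u => m (t - exitTime e u)) (by
      filter_upwards [ae_exitTime_pos he] with u hu
      exact h _ (by linarith)), add_zero] at h1
    exact (source_pos hA hr hr1 he).ne h1)
  set U : Set ℝ := Ioo 0 T ∩ {s | deriv m s ≠ 0}
  have hU : IsOpen U := isOpen_Ioo.inter
    (isOpen_ne_fun (hm.continuous_deriv (by simp)) continuous_const)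
  have hUpos := hU.measure_pos volume ⟨s, ⟨hs.1, hs.2.trans htT⟩, hds⟩
  refine top_le_iff.1 ?_
  calc (⊤ : ℝ≥0∞) = ∫⁻ _ in U, ⊤ := by rw [setLIntegral_const, ENNReal.top_mul hUpos.ne']
    _ ≤ ∫⁻ s in U, ∫⁻ p in gammaMinus,
          ‖gradX (transportSol (bumpDatum A r) m) s p.1 p.2‖ₑ ^ 2 ∂gammaMeasure :=
        setLIntegral_mono' hU.measurableSet fun s hs => (boundary_lintegral_eq_top
          (h := fun x v => gradX (transportSol (bumpDatum A r) m) s x v)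
          (abs_pos.2 hs.2) fun x v hx hv =>
            le_norm_gradX_transportSol hG hm hm0 hs.1.1 hx hv).ge
    _ ≤ _ := lintegral_mono_set (inter_subset_left.trans Ioo_subset_Icc_self)

theorem not_gradientEstimate_two (θ : ℝ) : ¬ GradientEstimate 2 θ := by
  rintro ⟨T, C, P, hT, h⟩
  -- The datum has weighted norm `1`, so `T 1` is its lifespan and may be used to choose it.
  obtain ⟨f₀, hf₀, hnorm, f, hf, hDx, hDv, htop⟩ := exists_datum_boundary_blowup θ (hT 1)
  have h1 := h f₀ hf₀ f hf _ _ hDx hDv (T 1) (hT 1).le (by rw [hnorm])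
  have h2 : (⊤ : ℝ≥0∞) ≤ ∫⁻ s in Icc 0 (T 1),
      (boundaryNormPow 2 (gradX f s) + boundaryNormPow 2 (gradV f s)) := by
    rw [← htop]
    refine lintegral_mono fun s => le_add_right ?_
    simp only [boundaryNormPow, ENNReal.rpow_two]
    exact setLIntegral_le_lintegral _ _
  have h3 := top_le_iff.1 ((h2.trans le_add_self).trans h1)
  obtain ⟨h4, h5⟩ := hf₀.bulkNormPow_two_lt_top
  exact ENNReal.mul_ne_top ENNReal.coe_ne_top
    (ENNReal.add_ne_top.2 ⟨ENNReal.add_ne_top.2 ⟨h4.ne, h5.ne⟩, ENNReal.ofReal_ne_top⟩) h3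

end

end KineticBall

theorem mainTheorem7 :
    (∃ f₀ : KineticBall.E3 → KineticBall.E3 → ℝ, KineticBall.IsDatum f₀ ∧
      ∃ f : ℝ → KineticBall.E3 → KineticBall.E3 → ℝ, KineticBall.IsSolution f₀ f ∧
        (∀ g, KineticBall.IsSolution f₀ g →
          ∀ t, 0 ≤ t → ∀ p ∈ KineticBall.phaseOffGrazing, g t p.1 p.2 = f t p.1 p.2) ∧
        ∃ Dx Dv : ℝ → KineticBall.E3 → KineticBall.E3 → KineticBall.E3,
          KineticBall.IsTrace (KineticBall.gradX f) Dx ∧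
          KineticBall.IsTrace (KineticBall.gradV f) Dv ∧
          ∫⁻ s in Set.Icc (0 : ℝ) 1, ∫⁻ p in KineticBall.gammaMinus,
            ‖Dx s p.1 p.2‖ₑ ^ 2 ∂KineticBall.gammaMeasure = ⊤) ∧
    (∀ θ : ℝ, 0 < θ → θ < 1 / 4 → ¬ KineticBall.GradientEstimate 2 θ) := by
  refine ⟨?_, fun θ _ _ => KineticBall.not_gradientEstimate_two θ⟩
  obtain ⟨f₀, hf₀, -, f, hf, hDx, hDv, htop⟩ :=
    KineticBall.exists_datum_boundary_blowup 0 one_pos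
  exact ⟨f₀, hf₀, f, hf, fun g hg t ht p hp => hg.unique hf ht hp, _, _, hDx, hDv, htop⟩
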